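/- Let $N\ge 1$ and let $\Omega=\bigcup_{i=1}^N\Omega_i\subset\mathbb R^2$, where the $\Omega_i$ are bounded (nonempty, open, connected) domains whose closures $\overline{\Omega_i}$ are pairwise disjoint, and each $\partial\Omega_i$ is the disjoint union of finitely many simple closed regular curves of class $C^1$. Let $B\in H^1(\Omega)$ be real-valued and suppose that $$m_0=m_0(B;\Omega):=\sup\{c\in\mathbb R: B(x)\ge c\ \text{for a.e. }x\in\Omega\}$$ is positive (the supremum over the empty set not being positive). Let $\mathbf A$ be a magnetic potential of $B$ in one of the following two senses: (a) $\mathbf A(x)=2\int_0^1 \tilde B(sx)\,\mathbf A_0(sx)\,ds$ with $\mathbf A_0(x)=\tfrac12(-x_2,x_1)$, where $\tilde B\in H^1(\mathbb R^2)$ is any real-valued function with $\tilde B=B$ a.e. on $\Omega$; or (b) $\mathbf A\in H^1(\Omega;\mathbb R^2)$ is any vector field with $\operatorname{curl}\mathbf A=\partial_{x_1}A_2-\partial_{x_2}A_1=B$ a.e. on $\Omega$. Let $$\lambda(\sigma,\mathbf A;\Omega)=\inf_{u\in H^1_0(\Omega;\mathbb C)\setminus\{0\}}\frac{\|(\nabla-i\sigma\mathbf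 A)u\|_{L^2(\Omega)}^2}{\|u\|_{L^2(\Omega)}^2}$$ be the lowest eigenvalue of the Dirichlet magnetic Laplacian $-(\nabla-i\sigma\mathbf A)^2$ on $\Omega$. Then $\lambda(\sigma,\mathbf A;\Omega)$ is finite and $$m_0\,\sigma\le\lambda(\sigma,\mathbf A;\Omega)\quad\text{for all }\sigma>0,\qquad \lambda(\sigma,\mathbf A;\Omega)\le m_0\,\sigma+o(\sigma)\quad(\sigma\to+\infty).$$ -/

import Mathlib

open MeasureTheory Filter Set
open scoped ENNReal ContDiff

noncomputable section

/-- The Euclidean plane. -/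
abbrev Plane : Type := EuclideanSpace ℝ (Fin 2)

/-- The standard basis vector `e_j` of the plane. -/
def stdVec (j : Fin 2) : Plane := EuclideanSpace.single j 1

/-- `γ` is a `1`-periodic parametrization of a simple closed regular curve of class `C¹`. -/
structure IsC1ClosedCurve (γ : ℝ → Plane) : Prop where
  contDiff : ContDiff ℝ 1 γ
  periodic : Function.Periodic γ 1
  simple : InjOn γ (Ico 0 1)
  regular : ∀ t, deriv γ t ≠ 0

/-- A bounded planar domain (nonempty, open and connected) whose boundary is the disjoint union of
finitely many simple closed regular `C¹` curves. -/
structure IsC1Domain (Ω : Set Plane) : Prop where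
  isOpen : IsOpen Ω
  isConnected : IsConnected Ω
  isBounded : Bornology.IsBounded Ω
  boundary : ∃ (m : ℕ) (γ : Fin m → ℝ → Plane), (∀ k, IsC1ClosedCurve (γ k)) ∧
    Pairwise (fun k l => Disjoint (range (γ k)) (range (γ l))) ∧
    frontier Ω = ⋃ k, range (γ k)

section Sobolev

variable {F : Type*} [NormedAddCommGroup F] [NormedSpace ℝ F]

/-- `g` is the weak partial derivative `∂_j u` on the open set `Ω`. -/
def HasWeakPartial (Ω : Set Plane) (j : Fin 2) (u g : Plane → F) : Prop :=
  ∀ φ : Plane → ℝ, ContDiff ℝ ∞ φ → HasCompactSupport φ → tsupport φ ⊆ Ω →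
    ∫ x in Ω, (fderiv ℝ φ x (stdVec j)) • u x = - ∫ x in Ω, φ x • g x

/-- `u ∈ H¹(Ω)`, with weak gradient `g = (g 0, g 1)`. -/
structure HasH1Grad (Ω : Set Plane) (u : Plane → F) (g : Fin 2 → Plane → F) : Prop where
  memLp : MemLp u 2 (volume.restrict Ω)
  memLp_grad : ∀ j, MemLp (g j) 2 (volume.restrict Ω)
  weak : ∀ j, HasWeakPartial Ω j u (g j)

/-- `u ∈ H¹(Ω)`. -/
def MemH1 (Ω : Set Plane) (u : Plane → F) : Prop :=
  ∃ g : Fin 2 → Plane → F, HasH1Grad Ω u g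

/-- `u ∈ H¹₀(Ω)`, with weak gradient `g`: `u` lies in the closure of `C_c^∞(Ω)` in `H¹(Ω)`. -/
structure HasH10Grad (Ω : Set Plane) (u : Plane → F) (g : Fin 2 → Plane → F) : Prop where
  hasH1Grad : HasH1Grad Ω u g
  approx : ∀ ε : ℝ≥0∞, 0 < ε → ∃ φ : Plane → F,
    ContDiff ℝ ∞ φ ∧ HasCompactSupport φ ∧ tsupport φ ⊆ Ω ∧
    eLpNorm (fun x => φ x - u x) 2 (volume.restrict Ω) ≤ ε ∧
    ∀ j, eLpNorm (fun x => fderiv ℝ φ x (stdVec j) - g j x) 2 (volume.restrict Ω) ≤ ε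

end Sobolev

/-- The vector field `A` belongs to `H¹(Ω; ℝ²)` and `curl A = ∂₁A₂ - ∂₂A₁ = B` on `Ω`. -/
def IsH1Potential (Ω : Set Plane) (B : Plane → ℝ) (A : Plane → Plane) : Prop :=
  ∃ D : Fin 2 → Fin 2 → Plane → ℝ,
    (∀ k, HasH1Grad Ω (fun x => A x k) (fun j => D j k)) ∧
    ∀ᵐ x ∂(volume.restrict Ω), D 0 1 x - D 1 0 x = B x

/-- The canonical magnetic potential `A₀(x) = (-x₂, x₁) / 2`. -/
def canonicalPotential (x : Plane) : Plane := (1 / 2 : ℝ) • !₂[-(x 1), x 0]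

/-- The magnetic potential `A(x) = 2 ∫₀¹ B(sx) A₀(sx) ds` generated by `B`. -/
def magneticPotential (B : Plane → ℝ) (x : Plane) : Plane :=
  (2 : ℝ) • ∫ s in (0 : ℝ)..1, B (s • x) • canonicalPotential (s • x)

/-- The magnetic energy `‖(∇ - iσA)u‖²` in `L²(Ω)`, where `g = ∇u`. -/
def magneticEnergy (σ : ℝ) (A : Plane → Plane) (Ω : Set Plane) (u : Plane → ℂ)
    (g : Fin 2 → Plane → ℂ) : ℝ≥0∞ :=
  ∫⁻ x in Ω, ∑ j, ‖g j x - Complex.I * (σ : ℂ) * ((A x j : ℝ) : ℂ) * u x‖ₑ ^ 2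

/-- The lowest eigenvalue `λ(σ, A; Ω)` of the Dirichlet magnetic Laplacian `-(∇ - iσA)²` on `Ω`:
the infimum of `‖(∇ - iσA)u‖² / ‖u‖²` over all nonzero `u ∈ H¹₀(Ω; ℂ)`. -/
def dirichletEigenvalue (σ : ℝ) (A : Plane → Plane) (Ω : Set Plane) : ℝ≥0∞ :=
  ⨅ (u : Plane → ℂ) (g : Fin 2 → Plane → ℂ) (_ : HasH10Grad Ω u g)
    (_ : ¬ (∀ᵐ x ∂(volume.restrict Ω), u x = 0)),
    magneticEnergy σ A Ω u g / ∫⁻ x in Ω, ‖u x‖ₑ ^ 2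

/-- The essential infimum `m₀(B; Ω) = sup {c : B ≥ c a.e. on Ω}`. -/
def essInfOn (B : Plane → ℝ) (Ω : Set Plane) : ℝ :=
  sSup {c : ℝ | ∀ᵐ x ∂(volume.restrict Ω), c ≤ B x}

end

noncomputable section

/-! Both kinds of potential are reduced to one situation: `A` is square integrable on `Ω` and its
distributional curl is `B` (`IsH1Potential.memLp_hasWeakCurl`,
`magneticPotential_memLp_hasWeakCurl`). The asymptotics are then proved in
`dirichletEigenvalue_asymptotics`. Write `D = ∇ - iσA` and `m₀ = essInfOn B Ω`.

Lower bound. For a test function `φ`, the density `|Dφ|²` equals `|(D₀ + iD₁)φ|²` plus twice the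
Jacobian of `(Re φ, Im φ)`, which integrates to zero, plus a term whose integral is `σ ∫ B |φ|²` by
the definition of the weak curl. Hence `m₀ σ ‖φ‖² ≤ ‖Dφ‖²`. On `H¹₀` the difficulty is that `A φₙ`
need not converge to `A u` in `L²`. The inequality is therefore passed to bounded smooth truncations
`T(u)`, and afterwards `T` tends to the identity (`mul_lintegral_le_magneticEnergy`).

Upper bound. Choose an `L²`-Lebesgue point `c` of `B` whose value `k = B c` is close to `m₀`, and
work on a ball of radius `l ~ σ^(-1/2)` about `c`. The radial potential of `B` centred at `c`
differs from `k A₀(x - c)` by `o(l²)` in `L²`. The difference between `A` and that radial potential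
is curl-free, so after mollification the Poincaré lemma makes it as close as desired in `L²` to a
gradient `∇θ` (`exists_gauge`), and the phase `exp(iσθ)` removes this gradient. The trial function
is a rescaled, cut-off Gaussian: its energy quotient in the constant field `k` is nearly `k`
(`exists_energy_le`), which scaling turns into `kσ`. The squared norm of the trial function is of
order `σ⁻¹`, while the potential error contributes at most a multiple of `σ² o(l⁴) = o(1)` to the
energy, hence `o(σ)` to the quotient (`eventually_dirichletEigenvalue_le`). -/

/-- `b` is the weak curl `∂₁A₂ - ∂₂A₁` of the vector field `A = (A 0, A 1)` on `Ω`. -/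
def HasWeakCurl (Ω : Set Plane) (A : Fin 2 → Plane → ℝ) (b : Plane → ℝ) : Prop :=
  ∀ φ : Plane → ℝ, ContDiff ℝ ∞ φ → HasCompactSupport φ → tsupport φ ⊆ Ω →
    ∫ x in Ω, (fderiv ℝ φ x (stdVec 0) * A 1 x - fderiv ℝ φ x (stdVec 1) * A 0 x) =
      - ∫ x in Ω, φ x * b x

/-! ### Integration by parts for test functions -/

section Calculus

variable {E F : Type*} [NormedAddCommGroup E] [NormedSpace ℝ E]
  [NormedAddCommGroup F] [NormedSpace ℝ F]

lemma ContDiff.fderiv_apply_const {f : E → F} (hf : ContDiff ℝ ∞ f) (v : E) :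
    ContDiff ℝ ∞ (fun x => fderiv ℝ f x v) :=
  (hf.fderiv_right (m := ∞) (by simp)).clm_apply contDiff_const

lemma HasCompactSupport.fderiv_apply_const {f : E → F} (hf : HasCompactSupport f) (v : E) :
    HasCompactSupport (fun x => fderiv ℝ f x v) :=
  (hf.fderiv (𝕜 := ℝ)).comp_left (g := fun L : E →L[ℝ] F => L v) (by simp)

end Calculus


lemma setIntegral_eq_integral_of_tsupport_subset {E F G : Type*} [TopologicalSpace E] [Zero F]
    [NormedAddCommGroup G] [NormedSpace ℝ G] [MeasurableSpace E] {μ : Measure E} {Ω : Set E}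
    {f : E → F} (hf : tsupport f ⊆ Ω) {g : E → G} (hg : ∀ x, f x = 0 → g x = 0) :
    ∫ x in Ω, g x ∂μ = ∫ x, g x ∂μ :=
  setIntegral_eq_integral_of_forall_compl_eq_zero fun x hx =>
    hg x (image_eq_zero_of_notMem_tsupport fun h => hx (hf h))

lemma integral_fderiv_eq_zero_of_hasCompactSupport {F : Type*} [NormedAddCommGroup F]
    [NormedSpace ℝ F] {f : Plane → F} (hf : ContDiff ℝ ∞ f) (hc : HasCompactSupport f) (v : Plane) :
    ∫ x, fderiv ℝ f x v = 0 := by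
  have h := integral_smul_fderiv_eq_neg_fderiv_smul_of_integrable (𝕜 := ℝ) (μ := volume)
    (f := fun _ : Plane => (1 : ℝ)) (g := f) (v := v) (by simp)
    (by simpa using ((hf.fderiv_apply_const v).continuous.integrable_of_hasCompactSupport
      (hc.fderiv_apply_const v) : Integrable _ volume))
    (by simpa using (hf.continuous.integrable_of_hasCompactSupport hc : Integrable _ volume))
    (fun x _ => differentiableAt_const _) (fun x _ => ((hf.differentiable (by simp)).differentiableAt : DifferentiableAt ℝ f x))
  simpa using h

lemma fderiv_fderiv_apply_comm {E F : Type*} [NormedAddCommGroup E] [NormedSpace ℝ E]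
    [NormedAddCommGroup F] [NormedSpace ℝ F] {f : E → F} (hf : ContDiff ℝ ∞ f) (x v w : E) :
    fderiv ℝ (fun y => fderiv ℝ f y v) x w = fderiv ℝ (fun y => fderiv ℝ f y w) x v := by
  have hd : DifferentiableAt ℝ (fderiv ℝ f) x :=
    ((hf.fderiv_right (m := ∞) (by simp)).differentiable (by simp)).differentiableAt
  have hs : IsSymmSndFDerivAt ℝ f x :=
    hf.contDiffAt.isSymmSndFDerivAt (by
      rw [minSmoothness_of_isRCLikeNormedField]; exact WithTop.coe_le_coe.2 le_top)
  rw [fderiv_clm_apply hd (differentiableAt_const _), fderiv_clm_apply hd (differentiableAt_const _)]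
  simpa using hs.eq w v

/-- The Jacobian determinant of a compactly supported smooth map has vanishing integral. -/
lemma integral_jacobian_eq_zero {p q : Plane → ℝ} (hp : ContDiff ℝ ∞ p) (hq : ContDiff ℝ ∞ q)
    (hpc : HasCompactSupport p) (v w : Plane) :
    ∫ x, (fderiv ℝ p x v * fderiv ℝ q x w - fderiv ℝ q x v * fderiv ℝ p x w) = 0 := by
  -- The Jacobian is the divergence `∂_v (p ∂_w q) - ∂_w (p ∂_v q)`; compact support of `p` suffices
  -- for both terms.
  have h1 := integral_fderiv_eq_zero_of_hasCompactSupport (hp.mul (hq.fderiv_apply_const w))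
    hpc.mul_right v
  have h2 := integral_fderiv_eq_zero_of_hasCompactSupport (hp.mul (hq.fderiv_apply_const v))
    hpc.mul_right w
  have i1 := ((hp.mul (hq.fderiv_apply_const w)).fderiv_apply_const v).continuous
    |>.integrable_of_hasCompactSupport (μ := volume) ((hpc.mul_right).fderiv_apply_const v)
  have i2 := ((hp.mul (hq.fderiv_apply_const v)).fderiv_apply_const w).continuous
    |>.integrable_of_hasCompactSupport (μ := volume) ((hpc.mul_right).fderiv_apply_const w)
  rw [← sub_zero (0 : ℝ)]
  nth_rw 1 [← h1]
  rw [← h2, ← integral_sub i1 i2]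
  congr 1 with x
  have hpd := (hp.differentiable (by simp)).differentiableAt (x := x)
  have hd := fun u => ((hq.fderiv_apply_const u).differentiable (by simp)).differentiableAt (x := x)
  rw [fderiv_fun_mul hpd (hd w), fderiv_fun_mul hpd (hd v)]
  simp only [_root_.add_apply, _root_.smul_apply, smul_eq_mul]
  rw [fderiv_fderiv_apply_comm hq x w v]
  ring

/-! ### The lower bound for test functions -/

lemma MemLp.continuous_mul {Ω : Set Plane} {f g : Plane → ℝ} (hg : Continuous g)
    (hc : HasCompactSupport g) (hf : MemLp f 2 (volume.restrict Ω)) :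
    MemLp (fun x => f x * g x) 2 (volume.restrict Ω) := by
  obtain ⟨C, hC⟩ := hg.bounded_above_of_compact_support hc
  have := hf.mul (p := ∞) (r := 2) (memLp_top_of_bound hg.aestronglyMeasurable C
    (Eventually.of_forall hC))
  exact this.congr_norm (hf.aestronglyMeasurable.mul hg.aestronglyMeasurable) (by simp [mul_comm])

lemma enorm_sq_eq_ofReal (z : ℂ) : ‖z‖ₑ ^ 2 = ENNReal.ofReal (z.re ^ 2 + z.im ^ 2) := by
  rw [← ofReal_norm, ← ENNReal.ofReal_pow (norm_nonneg _), Complex.sq_norm,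
    Complex.normSq_apply]
  ring_nf

lemma fderiv_re_apply {u : Plane → ℂ} {x : Plane} (hu : DifferentiableAt ℝ u x) (v : Plane) :
    fderiv ℝ (fun y => (u y).re) x v = (fderiv ℝ u x v).re := by
  have := (Complex.reCLM.hasFDerivAt.comp x hu.hasFDerivAt).fderiv
  exact congrArg (fun L => L v) this

lemma fderiv_im_apply {u : Plane → ℂ} {x : Plane} (hu : DifferentiableAt ℝ u x) (v : Plane) :
    fderiv ℝ (fun y => (u y).im) x v = (fderiv ℝ u x v).im := by
  have := (Complex.imCLM.hasFDerivAt.comp x hu.hasFDerivAt).fderiv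
  exact congrArg (fun L => L v) this

/-- The lower bound `σ m ‖φ‖² ≤ ‖(∇ - iσA)φ‖²` for test functions, if `curl A ≥ m`. -/
lemma mul_lintegral_le_magneticEnergy_of_contDiff {Ω : Set Plane} {A : Plane → Plane}
    {B : Plane → ℝ} (hA : ∀ k, MemLp (fun x => A x k) 2 (volume.restrict Ω))
    (hB : MemLp B 2 (volume.restrict Ω)) (hcurl : HasWeakCurl Ω (fun k x => A x k) B)
    {m : ℝ} (hm : ∀ᵐ x ∂(volume.restrict Ω), m ≤ B x) {σ : ℝ} (hσ : 0 < σ)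
    {φ : Plane → ℂ} (hφ : ContDiff ℝ ∞ φ) (hc : HasCompactSupport φ) (hs : tsupport φ ⊆ Ω) :
    ENNReal.ofReal (m * σ) * ∫⁻ x in Ω, ‖φ x‖ₑ ^ 2 ≤
      magneticEnergy σ A Ω φ (fun j x => fderiv ℝ φ x (stdVec j)) := by
  set p : Plane → ℝ := fun x => (φ x).re with hp_def
  set q : Plane → ℝ := fun x => (φ x).im with hq_def
  have hp : ContDiff ℝ ∞ p := Complex.reCLM.contDiff.comp hφ
  have hq : ContDiff ℝ ∞ q := Complex.imCLM.contDiff.comp hφ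
  have hpc : HasCompactSupport p := hc.comp_left (g := Complex.re) rfl
  have hqc : HasCompactSupport q := hc.comp_left (g := Complex.im) rfl
  have hps : tsupport p ⊆ Ω := (tsupport_comp_subset Complex.zero_re φ).trans hs
  have hqs : tsupport q ⊆ Ω := (tsupport_comp_subset Complex.zero_im φ).trans hs
  have hd : Differentiable ℝ φ := hφ.differentiable (by simp)
  have hL : ∀ {f : Plane → ℝ}, ContDiff ℝ ∞ f → HasCompactSupport f → ∀ v,
      MemLp (fun x => fderiv ℝ f x v) 2 (volume.restrict Ω) := fun hf hfc v =>
    ((hf.fderiv_apply_const v).continuous.memLp_of_hasCompactSupport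
      (hfc.fderiv_apply_const v)).restrict Ω
  -- The components of `(∇ - iσA)φ` are `X j + i Y j`.
  set X : Fin 2 → Plane → ℝ := fun j x => fderiv ℝ p x (stdVec j) + σ * (A x j * q x) with hX_def
  set Y : Fin 2 → Plane → ℝ := fun j x => fderiv ℝ q x (stdVec j) - σ * (A x j * p x) with hY_def
  have hX : ∀ j, MemLp (X j) 2 (volume.restrict Ω) := fun j =>
    (hL hp hpc _).add ((MemLp.continuous_mul hq.continuous hqc (hA j)).const_mul σ)
  have hY : ∀ j, MemLp (Y j) 2 (volume.restrict Ω) := fun j =>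
    (hL hq hqc _).sub ((MemLp.continuous_mul hp.continuous hpc (hA j)).const_mul σ)
  have hE : magneticEnergy σ A Ω φ (fun j x => fderiv ℝ φ x (stdVec j)) =
      ENNReal.ofReal (∫ x in Ω, ∑ j, (X j x ^ 2 + Y j x ^ 2)) := by
    rw [ofReal_integral_eq_lintegral_ofReal]
    · refine lintegral_congr fun x => ?_
      rw [ENNReal.ofReal_sum_of_nonneg fun j _ => by positivity]
      refine Finset.sum_congr rfl fun j _ => ?_
      rw [enorm_sq_eq_ofReal]
      congr 1
      simp only [hX_def, hY_def, hp_def, hq_def, fderiv_re_apply hd.differentiableAt,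
        fderiv_im_apply hd.differentiableAt]
      simp
      ring
    · exact integrable_finsetSum _ fun j _ => ((hX j).integrable_sq.add (hY j).integrable_sq)
    · exact Eventually.of_forall fun x => Finset.sum_nonneg fun j _ => by positivity
  set w : Plane → ℝ := fun x => p x * p x + q x * q x with hw_def
  have hw : ContDiff ℝ ∞ w := (hp.mul hp).add (hq.mul hq)
  have hwc : HasCompactSupport w := (hpc.mul_right).add (hqc.mul_right)
  have hws : tsupport w ⊆ Ω := by
    refine (closure_mono fun x hx => ?_).trans hs
    contrapose! hx
    simp only [Function.mem_support, not_not] at hx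
    simp [hw_def, hp_def, hq_def, hx]
  have hφw : ∫⁻ x in Ω, ‖φ x‖ₑ ^ 2 = ENNReal.ofReal (∫ x in Ω, w x) := by
    rw [ofReal_integral_eq_lintegral_ofReal]
    · refine lintegral_congr fun x => ?_
      rw [enorm_sq_eq_ofReal]
      simp only [hw_def, hp_def, hq_def, sq]
    · exact (hw.continuous.integrable_of_hasCompactSupport hwc).integrableOn
    · exact Eventually.of_forall fun x => add_nonneg (mul_self_nonneg _) (mul_self_nonneg _)
  have hwB : Integrable (fun x => w x * B x) (volume.restrict Ω) :=
    ((hw.continuous.memLp_of_hasCompactSupport (p := 2) hwc).restrict Ω).integrable_mul hB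
  have hwi : Integrable w (volume.restrict Ω) :=
    (hw.continuous.integrable_of_hasCompactSupport hwc).integrableOn
  have hmw : m * ∫ x in Ω, w x ≤ ∫ x in Ω, w x * B x := by
    rw [← integral_const_mul]
    refine integral_mono_ae (hwi.const_mul m) hwB ?_
    filter_upwards [hm] with x hx
    have : 0 ≤ w x := add_nonneg (mul_self_nonneg _) (mul_self_nonneg _)
    nlinarith
  have hJ : ∫ x in Ω, (fderiv ℝ p x (stdVec 0) * fderiv ℝ q x (stdVec 1) -
      fderiv ℝ q x (stdVec 0) * fderiv ℝ p x (stdVec 1)) = 0 := by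
    rw [← integral_jacobian_eq_zero hp hq hpc (stdVec 0) (stdVec 1)]
    refine setIntegral_eq_integral_of_forall_compl_eq_zero fun x hx => ?_
    have h0 : ∀ v, fderiv ℝ p x v = 0 := fun v => by
      rw [image_eq_zero_of_notMem_tsupport fun h => hx (hps (tsupport_fderiv_subset ℝ h))]; rfl
    simp [h0]
  have hcw := hcurl w hw hwc hws
  have hJi : Integrable (fun x => fderiv ℝ p x (stdVec 0) * fderiv ℝ q x (stdVec 1) -
      fderiv ℝ q x (stdVec 0) * fderiv ℝ p x (stdVec 1)) (volume.restrict Ω) :=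
    ((hL hp hpc _).integrable_mul (hL hq hqc _)).sub ((hL hq hqc _).integrable_mul (hL hp hpc _))
  have hcwi : Integrable (fun x => fderiv ℝ w x (stdVec 0) * A x 1 -
      fderiv ℝ w x (stdVec 1) * A x 0) (volume.restrict Ω) :=
    ((hL hw hwc _).integrable_mul (hA 1)).sub ((hL hw hwc _).integrable_mul (hA 0))
  -- Pointwise, `∑ (X j² + Y j²)` is a sum of two squares plus `2 (X 0 Y 1 - X 1 Y 0)`. Expanding
  -- the latter, the terms quadratic in `A` cancel; what remains is twice the Jacobian minus `σ`
  -- times the integrand of the weak curl tested against `w = |φ|²`.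
  have hkey : σ * ∫ x in Ω, w x * B x ≤ ∫ x in Ω, ∑ j, (X j x ^ 2 + Y j x ^ 2) := by
    have : σ * ∫ x in Ω, w x * B x = ∫ x in Ω, (2 * (fderiv ℝ p x (stdVec 0) *
        fderiv ℝ q x (stdVec 1) - fderiv ℝ q x (stdVec 0) * fderiv ℝ p x (stdVec 1)) -
        σ * (fderiv ℝ w x (stdVec 0) * A x 1 - fderiv ℝ w x (stdVec 1) * A x 0)) := by
      rw [integral_sub (hJi.const_mul 2) (hcwi.const_mul σ), integral_const_mul,
        integral_const_mul, hJ, hcw]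
      ring
    rw [this]
    refine integral_mono ((hJi.const_mul 2).sub (hcwi.const_mul σ))
      (integrable_finsetSum _ fun j _ => ((hX j).integrable_sq.add (hY j).integrable_sq))
      fun x => ?_
    have hwd : ∀ v, fderiv ℝ w x v = 2 * (p x * fderiv ℝ p x v + q x * fderiv ℝ q x v) := by
      intro v
      have hpd := (hp.differentiable (by simp)).differentiableAt (x := x)
      have hqd := (hq.differentiable (by simp)).differentiableAt (x := x)
      rw [hw_def, fderiv_fun_add (hpd.fun_mul hpd) (hqd.fun_mul hqd), fderiv_fun_mul hpd hpd,
        fderiv_fun_mul hqd hqd]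
      simp only [_root_.add_apply, _root_.smul_apply, smul_eq_mul]
      ring
    simp only [hwd, Fin.sum_univ_two, hX_def, hY_def]
    -- The two squares are those of the real and imaginary parts of `(D₀ + iD₁)φ`.
    nlinarith [sq_nonneg (fderiv ℝ p x (stdVec 0) + σ * (A x 0 * q x) -
      (fderiv ℝ q x (stdVec 1) - σ * (A x 1 * p x))), sq_nonneg (fderiv ℝ q x (stdVec 0) -
      σ * (A x 0 * p x) + (fderiv ℝ p x (stdVec 1) + σ * (A x 1 * q x)))]
  have hw0 : 0 ≤ ∫ x in Ω, w x :=
    integral_nonneg fun x => add_nonneg (mul_self_nonneg _) (mul_self_nonneg _)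
  rw [hE, hφw, ← ENNReal.ofReal_mul' hw0]
  refine ENNReal.ofReal_le_ofReal (le_trans ?_ hkey)
  calc m * σ * ∫ x in Ω, w x = σ * (m * ∫ x in Ω, w x) := by ring
    _ ≤ _ := mul_le_mul_of_nonneg_left hmw hσ.le

/-! ### Limit theorems in `L²` and truncations -/

lemma eLpNorm_two_sq {α F : Type*} [MeasurableSpace α] [NormedAddCommGroup F] (f : α → F)
    (μ : Measure α) : eLpNorm f 2 μ ^ 2 = ∫⁻ x, ‖f x‖ₑ ^ 2 ∂μ := by
  have := eLpNorm_nnreal_pow_eq_lintegral (f := f) (μ := μ) (p := 2) two_ne_zero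
  simpa using this

lemma tendsto_eLpNorm_two_zero_of_dominated {α F : Type*} [MeasurableSpace α]
    [NormedAddCommGroup F] {μ : Measure α} {f : ℕ → α → F} {G : α → ℝ}
    (hf : ∀ n, AEStronglyMeasurable (f n) μ) (hG : MemLp G 2 μ)
    (hb : ∀ n, ∀ᵐ x ∂μ, ‖f n x‖ ≤ G x)
    (hlim : ∀ᵐ x ∂μ, Tendsto (fun n => f n x) atTop (nhds 0)) :
    Tendsto (fun n => eLpNorm (f n) 2 μ) atTop (nhds 0) := by
  have h : Tendsto (fun n => ∫⁻ x, ‖f n x‖ₑ ^ 2 ∂μ) atTop (nhds (∫⁻ _, 0 ∂μ)) := by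
    refine tendsto_lintegral_of_dominated_convergence' (fun x => ‖G x‖ₑ ^ 2)
      (fun n => (hf n).enorm.pow_const 2) (fun n => ?_) ?_ ?_
    · filter_upwards [hb n] with x hx
      gcongr
      exact enorm_le_iff_norm_le.2 (hx.trans (Real.le_norm_self _))
    · rw [← eLpNorm_two_sq]
      exact ENNReal.pow_ne_top hG.eLpNorm_ne_top
    · filter_upwards [hlim] with x hx
      have := ENNReal.Tendsto.pow (n := 2) hx.enorm
      simpa using this
  have h2 := (ENNReal.continuous_rpow_const (y := 1 / 2)).tendsto _ |>.comp h
  simp only [lintegral_zero, one_div] at h2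
  refine (h2.congr fun n => ?_).trans (by simp)
  simp only [Function.comp_apply, ← eLpNorm_two_sq]
  rw [← ENNReal.rpow_natCast, ← ENNReal.rpow_mul]
  norm_num

/-- Fatou's lemma in the form needed for both limits in the lower bound: the mass converges only
pointwise, while the energies on the right converge. -/
lemma lintegral_le_of_tendsto_of_le {α : Type*} [MeasurableSpace α] {μ : Measure α}
    {f : ℕ → α → ℝ≥0∞} {F : α → ℝ≥0∞} {R : ℕ → ℝ≥0∞} {r : ℝ≥0∞}
    (hf : ∀ n, AEMeasurable (f n) μ) (hlim : ∀ᵐ x ∂μ, Tendsto (fun n => f n x) atTop (nhds (F x)))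
    (hle : ∀ n, ∫⁻ x, f n x ∂μ ≤ R n) (hR : Tendsto R atTop (nhds r)) : ∫⁻ x, F x ∂μ ≤ r :=
  calc ∫⁻ x, F x ∂μ = ∫⁻ x, liminf (fun n => f n x) atTop ∂μ :=
        lintegral_congr_ae (hlim.mono fun x hx => hx.liminf_eq.symm)
    _ ≤ liminf (fun n => ∫⁻ x, f n x ∂μ) atTop := lintegral_liminf_le' hf
    _ ≤ liminf R atTop := liminf_le_liminf (Eventually.of_forall hle)
    _ = r := hR.liminf_eq

/-- Smooth bounded truncations of the identity of `ℂ` with uniformly bounded derivatives. -/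
lemma exists_smooth_truncation : ∃ (C : ℝ) (T : ℕ → ℂ → ℂ),
    (∀ n, ContDiff ℝ ∞ (T n)) ∧ (∀ n, T n 0 = 0) ∧ (∀ n, ∃ M, ∀ z, ‖T n z‖ ≤ M) ∧
    (∀ n z, ‖T n z‖ ≤ ‖z‖) ∧ (∀ n z, ‖fderiv ℝ (T n) z‖ ≤ C) ∧
    ∀ z, ∀ᶠ n in atTop, T n z = z ∧ fderiv ℝ (T n) z = ContinuousLinearMap.id ℝ ℂ := by
  -- The profile is `T z = χ(z) z`, rescaled to `(n + 1) T(z / (n + 1))`. This rescaling leaves the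
  -- bound on the derivative unchanged and enlarges the disc on which the map is the identity.
  let χ : ContDiffBump (0 : ℂ) := ⟨1, 2, one_pos, one_lt_two⟩
  let T : ℂ → ℂ := fun z => χ z • z
  have hT : ContDiff ℝ ∞ T := χ.contDiff.smul contDiff_id
  have hTc : HasCompactSupport T := χ.hasCompactSupport.smul_right
  have hle : ∀ z, ‖T z‖ ≤ ‖z‖ := fun z => by
    rw [norm_smul, Real.norm_of_nonneg χ.nonneg]
    exact mul_le_of_le_one_left (norm_nonneg _) χ.le_one
  obtain ⟨M, hM⟩ := hT.continuous.bounded_above_of_compact_support hTc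
  obtain ⟨C, hC⟩ := (hT.continuous_fderiv (by simp)).bounded_above_of_compact_support
    (hTc.fderiv (𝕜 := ℝ))
  have hpos : ∀ n : ℕ, (0 : ℝ) < n + 1 := fun n => by positivity
  have hder : ∀ (n : ℕ) (z : ℂ), fderiv ℝ (fun z => ((n : ℝ) + 1) • T (((n : ℝ) + 1)⁻¹ • z)) z =
      fderiv ℝ T (((n : ℝ) + 1)⁻¹ • z) := fun n z => by
    have h1 : HasFDerivAt (fun z : ℂ => ((n : ℝ) + 1)⁻¹ • z)
        (((n : ℝ) + 1)⁻¹ • ContinuousLinearMap.id ℝ ℂ) z :=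
      (((n : ℝ) + 1)⁻¹ • ContinuousLinearMap.id ℝ ℂ).hasFDerivAt
    have h2 := (((hT.differentiable (by simp)) (((n : ℝ) + 1)⁻¹ • z)).hasFDerivAt.comp z h1).const_smul
      ((n : ℝ) + 1)
    refine h2.fderiv.trans ?_
    ext w
    simp only [_root_.smul_apply, ContinuousLinearMap.comp_apply, map_smul,
      ContinuousLinearMap.id_apply]
    rw [smul_inv_smul₀ (hpos n).ne']
  refine ⟨C, fun n z => ((n : ℝ) + 1) • T (((n : ℝ) + 1)⁻¹ • z),
    fun n => (hT.comp (contDiff_id.const_smul _)).const_smul _, fun n => by simp [T],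
    fun n => ⟨(n + 1) * M, fun z => ?_⟩, fun n z => ?_, fun n z => ?_, fun z => ?_⟩
  · rw [norm_smul, Real.norm_of_nonneg (hpos n).le]
    exact mul_le_mul_of_nonneg_left (hM _) (hpos n).le
  · rw [norm_smul, Real.norm_of_nonneg (hpos n).le]
    refine (mul_le_mul_of_nonneg_left (hle _) (hpos n).le).trans ?_
    rw [norm_smul, norm_inv, Real.norm_of_nonneg (hpos n).le, mul_inv_cancel_left₀ (hpos n).ne']
  · rw [hder]; exact hC _
  · obtain ⟨N, hN⟩ := exists_nat_gt ‖z‖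
    filter_upwards [eventually_ge_atTop N] with n hn
    have hlt : ‖((n : ℝ) + 1)⁻¹ • z‖ < 1 := by
      rw [norm_smul, norm_inv, Real.norm_of_nonneg (hpos n).le, inv_mul_lt_one₀ (hpos n)]
      have : (N : ℝ) ≤ n := by exact_mod_cast hn
      linarith
    have hTid : ∀ y : ℂ, ‖y‖ < 1 → T y = y := fun y hy => by
      simp only [T]
      rw [χ.one_of_mem_closedBall (by simpa using hy.le), one_smul]
    refine ⟨?_, ?_⟩
    · rw [hTid _ hlt, smul_inv_smul₀ (hpos n).ne']
    · rw [hder]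
      have : T =ᶠ[nhds (((n : ℝ) + 1)⁻¹ • z)] id := by
        filter_upwards [(isOpen_lt continuous_norm continuous_const).mem_nhds hlt] with y hy
          using hTid y hy
      rw [this.fderiv_eq, fderiv_id]

lemma fderiv_complexComp_apply {T : ℂ → ℂ} (hT : ContDiff ℝ ∞ T) {φ : Plane → ℂ} (hφ : ContDiff ℝ ∞ φ)
    (x v : Plane) : fderiv ℝ (fun y => T (φ y)) x v = fderiv ℝ T (φ x) (fderiv ℝ φ x v) := by
  have := ((hT.differentiable (by simp) (φ x)).hasFDerivAt.comp x
    (hφ.differentiable (by simp) x).hasFDerivAt).fderiv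
  exact congrArg (fun L => L v) this

/-- Test functions approximating `u ∈ H¹₀(Ω)` can be chosen to converge almost everywhere. -/
lemma HasH10Grad.exists_seq {Ω : Set Plane} {u : Plane → ℂ} {g : Fin 2 → Plane → ℂ}
    (hu : HasH10Grad Ω u g) : ∃ φ : ℕ → Plane → ℂ,
      (∀ n, ContDiff ℝ ∞ (φ n) ∧ HasCompactSupport (φ n) ∧ tsupport (φ n) ⊆ Ω) ∧
      (∀ᵐ x ∂(volume.restrict Ω), Tendsto (fun n => φ n x) atTop (nhds (u x))) ∧
      ∀ j, Tendsto (fun n => eLpNorm (fun x => fderiv ℝ (φ n) x (stdVec j) - g j x) 2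
        (volume.restrict Ω)) atTop (nhds 0) := by
  have h0 : Tendsto (fun n : ℕ => (n : ℝ≥0∞)⁻¹) atTop (nhds 0) :=
    ENNReal.tendsto_inv_nat_nhds_zero
  choose ψ hψ1 hψ2 hψ3 hψ4 hψ5 using fun n : ℕ => hu.approx (n : ℝ≥0∞)⁻¹ (by simp)
  -- Convergence in `L²` gives convergence in measure, hence almost everywhere along a subsequence.
  have hmeas : TendstoInMeasure (volume.restrict Ω) ψ atTop u :=
    tendstoInMeasure_of_tendsto_eLpNorm two_ne_zero
      (fun n => (hψ1 n).continuous.aestronglyMeasurable) hu.hasH1Grad.memLp.aestronglyMeasurable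
      (tendsto_of_tendsto_of_tendsto_of_le_of_le tendsto_const_nhds h0 (fun _ => zero_le)
        (fun n => hψ4 n))
  obtain ⟨ns, hns, hae⟩ := hmeas.exists_seq_tendsto_ae
  refine ⟨fun n => ψ (ns n), fun n => ⟨hψ1 _, hψ2 _, hψ3 _⟩, hae, fun j => ?_⟩
  exact tendsto_of_tendsto_of_tendsto_of_le_of_le tendsto_const_nhds (h0.comp hns.tendsto_atTop)
    (fun _ => zero_le) (fun n => hψ5 (ns n) j)

/-! ### The lower bound on `H¹₀` -/

section LowerBound

variable {Ω : Set Plane} {A : Plane → Plane} {B : Plane → ℝ}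

lemma magneticEnergy_eq_sum {σ : ℝ} {u : Plane → ℂ} {g : Fin 2 → Plane → ℂ}
    (h : ∀ j, AEStronglyMeasurable (fun x => g j x - Complex.I * (σ : ℂ) * ((A x j : ℝ) : ℂ) * u x)
      (volume.restrict Ω)) :
    magneticEnergy σ A Ω u g = ∑ j, eLpNorm (fun x => g j x -
      Complex.I * (σ : ℂ) * ((A x j : ℝ) : ℂ) * u x) 2 (volume.restrict Ω) ^ 2 := by
  simp only [magneticEnergy, eLpNorm_two_sq]
  exact lintegral_finsetSum' _ fun j _ => (h j).enorm.pow_const 2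

/-- If `φₙ → u` in `H¹` and almost everywhere, the `T(φₙ)` are again test functions. As `T` is
bounded, `|A| |T(φₙ) - T(u)|` is dominated by a multiple of `|A| ∈ L²`, so the magnetic gradients
converge in `L²`. Without `T` the product `A u` could not be controlled. -/
lemma mul_lintegral_le_magneticEnergy_comp
    (hA : ∀ k, MemLp (fun x => A x k) 2 (volume.restrict Ω))
    (hB : MemLp B 2 (volume.restrict Ω)) (hcurl : HasWeakCurl Ω (fun k x => A x k) B)
    {m : ℝ} (hm : ∀ᵐ x ∂(volume.restrict Ω), m ≤ B x) {σ : ℝ} (hσ : 0 < σ)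
    {u : Plane → ℂ} {g : Fin 2 → Plane → ℂ} (hu : HasH10Grad Ω u g)
    {T : ℂ → ℂ} (hT : ContDiff ℝ ∞ T) (hT0 : T 0 = 0) {M C : ℝ} (hM : ∀ z, ‖T z‖ ≤ M)
    (hC : ∀ z, ‖fderiv ℝ T z‖ ≤ C) :
    ENNReal.ofReal (m * σ) * ∫⁻ x in Ω, ‖T (u x)‖ₑ ^ 2 ≤
      magneticEnergy σ A Ω (fun x => T (u x)) (fun j x => fderiv ℝ T (u x) (g j x)) := by
  obtain ⟨φ, hφ, hae, hgrad⟩ := hu.exists_seq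
  have hum := hu.hasH1Grad.memLp.aestronglyMeasurable
  have hgL := hu.hasH1Grad.memLp_grad
  have hC0 : 0 ≤ C := (norm_nonneg _).trans (hC 0)
  have hDT : Continuous (fderiv ℝ T) := hT.continuous_fderiv (by simp)
  have hAm : ∀ k, AEStronglyMeasurable (fun x => Complex.I * (σ : ℂ) * ((A x k : ℝ) : ℂ))
      (volume.restrict Ω) := fun k =>
    (Complex.continuous_ofReal.comp_aestronglyMeasurable (hA k).aestronglyMeasurable).const_mul _
  set X : Fin 2 → Plane → ℂ := fun j x =>
    fderiv ℝ T (u x) (g j x) - Complex.I * (σ : ℂ) * ((A x j : ℝ) : ℂ) * T (u x) with hX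
  set Xn : ℕ → Fin 2 → Plane → ℂ := fun n j x =>
    fderiv ℝ T (φ n x) (fderiv ℝ (φ n) x (stdVec j)) -
      Complex.I * (σ : ℂ) * ((A x j : ℝ) : ℂ) * T (φ n x) with hXn
  have happ : ∀ {f : Plane → ℂ} {h : Plane → ℂ}, AEStronglyMeasurable f (volume.restrict Ω) →
      AEStronglyMeasurable h (volume.restrict Ω) →
      AEStronglyMeasurable (fun x => fderiv ℝ T (f x) (h x)) (volume.restrict Ω) :=
    fun hf hh => ((hDT.comp continuous_fst).clm_apply continuous_snd).comp_aestronglyMeasurable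
      (hf.prodMk hh)
  have hXm : ∀ j, AEStronglyMeasurable (X j) (volume.restrict Ω) := fun j =>
    (happ hum (hgL j).aestronglyMeasurable).sub
      ((hAm j).mul (hT.continuous.comp_aestronglyMeasurable hum))
  have hφm : ∀ n, AEStronglyMeasurable (φ n) (volume.restrict Ω) := fun n =>
    (hφ n).1.continuous.aestronglyMeasurable
  have hφgm : ∀ n j, AEStronglyMeasurable (fun x => fderiv ℝ (φ n) x (stdVec j))
      (volume.restrict Ω) := fun n j =>
    ((hφ n).1.fderiv_apply_const _).continuous.aestronglyMeasurable
  have hXnm : ∀ n j, AEStronglyMeasurable (Xn n j) (volume.restrict Ω) := fun n j =>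
    (happ (hφm n) (hφgm n j)).sub
      ((hAm j).mul (hT.continuous.comp_aestronglyMeasurable (hφm n)))
  have hlim : ∀ j, Tendsto (fun n => eLpNorm (Xn n j - X j) 2 (volume.restrict Ω)) atTop
      (nhds 0) := by
    intro j
    -- The error splits into the change of the gradient (`a`, controlled by the Lipschitz bound
    -- `C`), the change of `DT` at fixed gradient (`b`) and the potential term (`c`); the last two
    -- tend to zero by dominated convergence.
    set a : ℕ → Plane → ℂ := fun n x =>
      fderiv ℝ T (φ n x) (fderiv ℝ (φ n) x (stdVec j) - g j x) with ha
    set b : ℕ → Plane → ℂ := fun n x =>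
      (fderiv ℝ T (φ n x) (g j x) - fderiv ℝ T (u x) (g j x)) with hb
    set c : ℕ → Plane → ℂ := fun n x =>
      Complex.I * (σ : ℂ) * ((A x j : ℝ) : ℂ) * (T (φ n x) - T (u x)) with hc
    have ham : ∀ n, AEStronglyMeasurable (a n) (volume.restrict Ω) := fun n =>
      happ (hφm n) ((hφgm n j).sub (hgL j).aestronglyMeasurable)
    have hbm : ∀ n, AEStronglyMeasurable (b n) (volume.restrict Ω) := fun n =>
      (happ (hφm n) (hgL j).aestronglyMeasurable).sub (happ hum (hgL j).aestronglyMeasurable)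
    have hcm : ∀ n, AEStronglyMeasurable (c n) (volume.restrict Ω) := fun n =>
      (hAm j).mul ((hT.continuous.comp_aestronglyMeasurable (hφm n)).sub
        (hT.continuous.comp_aestronglyMeasurable hum))
    have hsum : ∀ n, Xn n j - X j = a n + b n - c n := fun n => by
      ext x
      simp only [hXn, hX, ha, hb, hc, Pi.sub_apply, Pi.add_apply, map_sub]
      ring
    have ta : Tendsto (fun n => eLpNorm (a n) 2 (volume.restrict Ω)) atTop (nhds 0) := by
      have := ENNReal.Tendsto.const_mul (a := ENNReal.ofReal C) (hgrad j)
        (Or.inr ENNReal.ofReal_ne_top)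
      rw [mul_zero] at this
      refine tendsto_of_tendsto_of_tendsto_of_le_of_le tendsto_const_nhds this
        (fun _ => zero_le) fun n => ?_
      exact eLpNorm_le_mul_eLpNorm_of_ae_le_mul (Eventually.of_forall fun x =>
        (ContinuousLinearMap.le_opNorm _ _).trans
          (mul_le_mul_of_nonneg_right (hC _) (norm_nonneg _))) 2
    have tb : Tendsto (fun n => eLpNorm (b n) 2 (volume.restrict Ω)) atTop (nhds 0) := by
      refine tendsto_eLpNorm_two_zero_of_dominated hbm ((hgL j).norm.const_mul (2 * C))
        (fun n => Eventually.of_forall fun x => ?_) ?_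
      · refine (norm_sub_le _ _).trans ?_
        have h1 := fun z => ((fderiv ℝ T z).le_opNorm (g j x)).trans
          (mul_le_mul_of_nonneg_right (hC z) (norm_nonneg _))
        linarith [h1 (φ n x), h1 (u x)]
      · filter_upwards [hae] with x hx
        have h1 := ((hDT.clm_apply (continuous_const (y := g j x))).tendsto (u x)).comp hx
        have h2 := h1.sub_const (fderiv ℝ T (u x) (g j x))
        rwa [sub_self] at h2
    have tc : Tendsto (fun n => eLpNorm (c n) 2 (volume.restrict Ω)) atTop (nhds 0) := by
      refine tendsto_eLpNorm_two_zero_of_dominated hcm ((hA j).norm.const_mul (σ * (2 * M)))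
        (fun n => Eventually.of_forall fun x => ?_) ?_
      · have h1 : ‖T (φ n x) - T (u x)‖ ≤ 2 * M := by
          linarith [norm_sub_le (T (φ n x)) (T (u x)), hM (φ n x), hM (u x)]
        simp only [hc, norm_mul, Complex.norm_I, one_mul, Complex.norm_real,
          Real.norm_of_nonneg hσ.le]
        calc σ * ‖A x j‖ * ‖T (φ n x) - T (u x)‖ ≤ σ * ‖A x j‖ * (2 * M) := by gcongr
          _ = _ := by ring
      · filter_upwards [hae] with x hx
        have h1 := ((hT.continuous.tendsto (u x)).comp hx).sub_const (T (u x))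
        rw [sub_self] at h1
        simpa using h1.const_mul (Complex.I * (σ : ℂ) * ((A x j : ℝ) : ℂ))
    have tabc := (ta.add tb).add tc
    simp only [add_zero] at tabc
    refine tendsto_of_tendsto_of_tendsto_of_le_of_le tendsto_const_nhds tabc
      (fun _ => zero_le) fun n => ?_
    rw [hsum n]
    refine (eLpNorm_sub_le ((ham n).add (hbm n)) (hcm n) one_le_two).trans ?_
    gcongr
    exact eLpNorm_add_le (ham n) (hbm n) one_le_two
  rw [magneticEnergy_eq_sum hXm, ← lintegral_const_mul' _ _ ENNReal.ofReal_ne_top]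
  refine lintegral_le_of_tendsto_of_le
    (f := fun n x => ENNReal.ofReal (m * σ) * ‖T (φ n x)‖ₑ ^ 2)
    (R := fun n => ∑ j, (eLpNorm (X j) 2 (volume.restrict Ω) +
      eLpNorm (Xn n j - X j) 2 (volume.restrict Ω)) ^ 2) (fun n => ?_) ?_ (fun n => ?_) ?_
  · exact (((hT.continuous.comp_aestronglyMeasurable (hφm n)).enorm.pow_const 2).const_mul _)
  · filter_upwards [hae] with x hx
    refine ENNReal.Tendsto.const_mul ?_ (Or.inr ENNReal.ofReal_ne_top)
    exact ENNReal.Tendsto.pow ((((hT.continuous.tendsto (u x)).comp hx)).enorm)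
  · rw [lintegral_const_mul' _ _ ENNReal.ofReal_ne_top]
    have hTφ : ContDiff ℝ ∞ (fun x => T (φ n x)) := hT.comp (hφ n).1
    refine (mul_lintegral_le_magneticEnergy_of_contDiff hA hB hcurl hm hσ hTφ
      ((hφ n).2.1.comp_left hT0) ((tsupport_comp_subset hT0 _).trans (hφ n).2.2)).trans ?_
    simp only [fderiv_complexComp_apply hT (hφ n).1]
    rw [magneticEnergy_eq_sum (hXnm n)]
    refine Finset.sum_le_sum fun j _ => ?_
    gcongr
    calc eLpNorm (Xn n j) 2 (volume.restrict Ω)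
        = eLpNorm (X j + (Xn n j - X j)) 2 (volume.restrict Ω) := by rw [add_sub_cancel]
      _ ≤ _ := eLpNorm_add_le (hXm j) ((hXnm n j).sub (hXm j)) one_le_two
  · refine tendsto_finsetSum _ fun j _ => ?_
    have := (hlim j).const_add (eLpNorm (X j) 2 (volume.restrict Ω))
    rw [add_zero] at this
    exact ENNReal.Tendsto.pow this

/-- If `curl A ≥ m` then `σ m ‖u‖² ≤ ‖(∇ - iσA)u‖²` for all `u ∈ H¹₀(Ω)`. -/
lemma mul_lintegral_le_magneticEnergy
    (hA : ∀ k, MemLp (fun x => A x k) 2 (volume.restrict Ω))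
    (hB : MemLp B 2 (volume.restrict Ω)) (hcurl : HasWeakCurl Ω (fun k x => A x k) B)
    {m : ℝ} (hm : ∀ᵐ x ∂(volume.restrict Ω), m ≤ B x) {σ : ℝ} (hσ : 0 < σ)
    {u : Plane → ℂ} {g : Fin 2 → Plane → ℂ} (hu : HasH10Grad Ω u g) :
    ENNReal.ofReal (m * σ) * ∫⁻ x in Ω, ‖u x‖ₑ ^ 2 ≤ magneticEnergy σ A Ω u g := by
  have hum := hu.hasH1Grad.memLp.aestronglyMeasurable
  have hgL := hu.hasH1Grad.memLp_grad
  set X : Fin 2 → Plane → ℂ := fun j x =>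
    g j x - Complex.I * (σ : ℂ) * ((A x j : ℝ) : ℂ) * u x with hX
  have hAm : ∀ k, AEStronglyMeasurable (fun x => Complex.I * (σ : ℂ) * ((A x k : ℝ) : ℂ))
      (volume.restrict Ω) := fun k =>
    (Complex.continuous_ofReal.comp_aestronglyMeasurable (hA k).aestronglyMeasurable).const_mul _
  have hXm : ∀ j, AEStronglyMeasurable (X j) (volume.restrict Ω) := fun j =>
    (hgL j).aestronglyMeasurable.sub ((hAm j).mul hum)
  -- When the energy is finite, `g j - iσ A_j u` lies in `L²`. Since `g j` does too, so does `A_j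
  -- u`, and this provides the majorant needed to remove the truncation.
  by_cases htop : magneticEnergy σ A Ω u g = ⊤
  · rw [htop]; exact le_top
  have hXL : ∀ j, MemLp (X j) 2 (volume.restrict Ω) := fun j => by
    refine ⟨hXm j, lt_top_iff_ne_top.2 fun h => htop ?_⟩
    rw [magneticEnergy_eq_sum hXm, ENNReal.sum_eq_top]
    exact ⟨j, Finset.mem_univ _, by rw [h]; rfl⟩
  obtain ⟨C, T, hT, hT0, hTM, hTle, hTC, hTid⟩ := exists_smooth_truncation
  have hC0 : 0 ≤ C := (norm_nonneg _).trans (hTC 0 0)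
  rw [← lintegral_const_mul' _ _ ENNReal.ofReal_ne_top]
  refine lintegral_le_of_tendsto_of_le
    (f := fun n x => ENNReal.ofReal (m * σ) * ‖T n (u x)‖ₑ ^ 2)
    (R := fun n => magneticEnergy σ A Ω (fun x => T n (u x))
      (fun j x => fderiv ℝ (T n) (u x) (g j x))) (fun n => ?_) ?_ (fun n => ?_) ?_
  · exact ((((hT n).continuous.comp_aestronglyMeasurable hum).enorm.pow_const 2).const_mul _)
  · refine Eventually.of_forall fun x => tendsto_const_nhds.congr' ?_
    filter_upwards [hTid (u x)] with n hn
    rw [hn.1]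
  · rw [lintegral_const_mul' _ _ ENNReal.ofReal_ne_top]
    obtain ⟨M, hM⟩ := hTM n
    exact mul_lintegral_le_magneticEnergy_comp hA hB hcurl hm hσ hu (hT n) (hT0 n) hM (hTC n)
  · have hGL : ∀ j, MemLp (fun x => C * ‖g j x‖ + (‖X j x‖ + ‖g j x‖)) 2 (volume.restrict Ω) :=
      fun j => ((hgL j).norm.const_mul C).add ((hXL j).norm.add (hgL j).norm)
    refine tendsto_lintegral_of_dominated_convergence'
      (fun x => ∑ j, ‖C * ‖g j x‖ + (‖X j x‖ + ‖g j x‖)‖ₑ ^ 2) (fun n => ?_) (fun n => ?_) ?_ ?_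
    · refine Finset.aemeasurable_fun_sum _ fun j _ => AEMeasurable.pow_const ?_ 2
      exact (((((hT n).continuous_fderiv (by simp)).comp continuous_fst).clm_apply
        continuous_snd).comp_aestronglyMeasurable (hum.prodMk (hgL j).aestronglyMeasurable) |>.sub
        ((hAm j).mul ((hT n).continuous.comp_aestronglyMeasurable hum))).enorm
    · refine Eventually.of_forall fun x => Finset.sum_le_sum fun j _ => ?_
      gcongr
      refine enorm_le_iff_norm_le.2 (le_trans ?_ (Real.le_norm_self _))
      refine (norm_sub_le _ _).trans (add_le_add ?_ ?_)
      · exact ((fderiv ℝ (T n) (u x)).le_opNorm (g j x)).trans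
          (mul_le_mul_of_nonneg_right (hTC n _) (norm_nonneg _))
      · rw [norm_mul]
        refine (mul_le_mul_of_nonneg_left (hTle n (u x)) (norm_nonneg _)).trans ?_
        rw [← norm_mul]
        have : Complex.I * (σ : ℂ) * ((A x j : ℝ) : ℂ) * u x = g j x - X j x := by
          simp only [hX]; ring
        rw [this, add_comm]
        exact norm_sub_le _ _
    · rw [lintegral_finsetSum' _ fun j _ => (hGL j).aestronglyMeasurable.enorm.pow_const 2]
      refine ENNReal.sum_ne_top.2 fun j _ => ?_
      rw [← eLpNorm_two_sq]
      exact ENNReal.pow_ne_top (hGL j).eLpNorm_ne_top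
    · refine Eventually.of_forall fun x => tendsto_const_nhds.congr' ?_
      filter_upwards [hTid (u x)] with n hn
      rw [hn.1, hn.2]
      rfl

end LowerBound

/-! ### `L²` bounds for the radial potential -/

/-- The weighted radial mean `∫₀¹ s b(sx) ds`. -/
def radialMean (b : Plane → ℝ) (x : Plane) : ℝ := ∫ s in Ioc (0 : ℝ) 1, s * b (s • x)

/-- The components of the potential `2 ∫₀¹ b(sx) A₀(sx) ds`. -/
def radialPotential (b : Plane → ℝ) (k : Fin 2) (x : Plane) : ℝ :=
  radialMean b x * (2 * canonicalPotential x k)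

lemma canonicalPotential_smul (s : ℝ) (x : Plane) :
    canonicalPotential (s • x) = s • canonicalPotential x := by
  ext k
  fin_cases k <;> simp [canonicalPotential] <;> ring

/-- `A₀` is homogeneous of degree one, so `A₀(sx)` contributes a factor `s` and `A₀(x)` leaves the
integral. -/
lemma magneticPotential_apply (b : Plane → ℝ) (x : Plane) (k : Fin 2) :
    magneticPotential b x k = radialPotential b k x := by
  have : ∀ s : ℝ, b (s • x) • canonicalPotential (s • x) =
      (s * b (s • x)) • canonicalPotential x := fun s => by
    rw [canonicalPotential_smul, smul_smul, mul_comm]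
  simp only [magneticPotential, this, intervalIntegral.integral_of_le zero_le_one]
  rw [integral_smul_const]
  simp [radialPotential, radialMean]
  ring

/-- The square of an integral over a space of mass at most one is bounded by the integral of the
square. -/
lemma lintegral_sq_le {α : Type*} [MeasurableSpace α] {μ : Measure α} (hμ : μ univ ≤ 1)
    {f : α → ℝ≥0∞} (hf : AEMeasurable f μ) : (∫⁻ x, f x ∂μ) ^ 2 ≤ ∫⁻ x, f x ^ 2 ∂μ := by
  have h := ENNReal.lintegral_mul_le_Lp_mul_Lq μ Real.HolderConjugate.two_two hf
    (aemeasurable_const (b := (1 : ℝ≥0∞)))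
  simp only [Pi.mul_apply, mul_one, ENNReal.one_rpow, lintegral_const, one_mul] at h
  have h2 : ∫⁻ x, f x ∂μ ≤ (∫⁻ x, f x ^ (2 : ℝ) ∂μ) ^ (1 / 2 : ℝ) :=
    h.trans (mul_le_of_le_one_right zero_le (ENNReal.rpow_le_one hμ (by norm_num)))
  calc (∫⁻ x, f x ∂μ) ^ 2 ≤ ((∫⁻ x, f x ^ (2 : ℝ) ∂μ) ^ (1 / 2 : ℝ)) ^ 2 := by gcongr
    _ = ∫⁻ x, f x ^ 2 ∂μ := by
      rw [← ENNReal.rpow_natCast, ← ENNReal.rpow_mul]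
      norm_num

lemma lintegral_comp_smul_of_pos (f : Plane → ℝ≥0∞) {s : ℝ} (hs : 0 < s) :
    ∫⁻ x, f (s • x) = ENNReal.ofReal (s ^ 2)⁻¹ * ∫⁻ x, f x := by
  have he : MeasurableEmbedding (fun x : Plane => s • x) :=
    (Homeomorph.smulOfNeZero s hs.ne').measurableEmbedding
  rw [← he.lintegral_map, Measure.map_addHaar_smul volume hs.ne', lintegral_smul_measure]
  simp [abs_of_pos (pow_pos hs 2)]

lemma aestronglyMeasurable_mul_comp_smul {b : Plane → ℝ} (hb : AEStronglyMeasurable b volume)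
    (ν : Measure Plane) [SFinite ν] (hν : ν ≪ volume) :
    AEStronglyMeasurable (fun p : Plane × ℝ => p.2 * b (p.2 • p.1))
      (ν.prod (volume.restrict (Ioc (0 : ℝ) 1))) := by
  refine measurable_snd.aestronglyMeasurable.mul (hb.comp_quasiMeasurePreserving
    (QuasiMeasurePreserving.prod_of_left (by fun_prop) ?_))
  filter_upwards [ae_restrict_mem measurableSet_Ioc] with s hs
  exact (Measure.quasiMeasurePreserving_smul volume hs.1.ne').mono_left hν

/-- The dilation by `s ≤ 1` maps the ball into itself, and the factor `s²` compensates the planar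
Jacobian. -/
lemma lintegral_closedBall_comp_smul_le (h : Plane → ℝ≥0∞) {l s : ℝ} (hs : s ∈ Ioc (0 : ℝ) 1) :
    ENNReal.ofReal (s ^ 2) * ∫⁻ x in Metric.closedBall 0 l, h (s • x) ≤
      ∫⁻ x in Metric.closedBall 0 l, h x := by
  have hs2 : 0 < s ^ 2 := pow_pos hs.1 2
  rw [← lintegral_indicator Metric.isClosed_closedBall.measurableSet,
    ← lintegral_indicator Metric.isClosed_closedBall.measurableSet]
  have : ∫⁻ x, (Metric.closedBall 0 l).indicator (fun x => h (s • x)) x ≤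
      ∫⁻ x, (Metric.closedBall 0 l).indicator h (s • x) := by
    refine lintegral_mono fun x => ?_
    by_cases hx : x ∈ Metric.closedBall (0 : Plane) l
    · have : s • x ∈ Metric.closedBall (0 : Plane) l := by
        rw [mem_closedBall_zero_iff] at hx ⊢
        rw [norm_smul, Real.norm_of_nonneg hs.1.le]
        exact (mul_le_of_le_one_left (norm_nonneg _) hs.2).trans hx
      rw [indicator_of_mem hx, indicator_of_mem this]
    · rw [indicator_of_notMem hx]
      exact zero_le
  rw [lintegral_comp_smul_of_pos _ hs.1] at this
  calc _ ≤ ENNReal.ofReal (s ^ 2) * (ENNReal.ofReal (s ^ 2)⁻¹ *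
        ∫⁻ x, (Metric.closedBall 0 l).indicator h x) := by gcongr
    _ = _ := by
      rw [← mul_assoc, ← ENNReal.ofReal_mul hs2.le, mul_inv_cancel₀ hs2.ne', ENNReal.ofReal_one,
        one_mul]

/-- The kernel of the radial mean is bounded in `L²` of the product. -/
lemma lintegral_prod_mul_comp_smul_le {b : Plane → ℝ} (hb : AEStronglyMeasurable b volume) (l : ℝ) :
    ∫⁻ x in Metric.closedBall 0 l, ∫⁻ s in Ioc (0 : ℝ) 1, ‖s * b (s • x)‖ₑ ^ 2 ≤
      ∫⁻ x in Metric.closedBall 0 l, ‖b x‖ₑ ^ 2 := by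
  rw [lintegral_lintegral_swap ((aestronglyMeasurable_mul_comp_smul hb _
    Measure.absolutelyContinuous_restrict).enorm.pow_const 2)]
  calc _ ≤ ∫⁻ s in Ioc (0 : ℝ) 1, ∫⁻ x in Metric.closedBall (0 : Plane) l, ‖b x‖ₑ ^ 2 := by
        refine setLIntegral_mono' measurableSet_Ioc fun s hs => ?_
        refine le_trans (le_of_eq ?_) (lintegral_closedBall_comp_smul_le (fun x => ‖b x‖ₑ ^ 2) hs)
        rw [← lintegral_const_mul' _ _ ENNReal.ofReal_ne_top]
        refine lintegral_congr fun x => ?_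
        rw [enorm_mul, mul_pow, Real.enorm_of_nonneg hs.1.le, ENNReal.ofReal_pow hs.1.le]
    _ = _ := by simp

lemma memLp_prod_mul_comp_smul {b : Plane → ℝ} (hb : MemLp b 2 volume) (l : ℝ) :
    MemLp (fun p : Plane × ℝ => p.2 * b (p.2 • p.1)) 2
      ((volume.restrict (Metric.closedBall 0 l)).prod (volume.restrict (Ioc (0 : ℝ) 1))) := by
  have hGm := aestronglyMeasurable_mul_comp_smul hb.aestronglyMeasurable
    (volume.restrict (Metric.closedBall (0 : Plane) l)) Measure.absolutelyContinuous_restrict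
  refine ⟨hGm, ?_⟩
  have h1 : ∫⁻ x in Metric.closedBall (0 : Plane) l, ‖b x‖ₑ ^ 2 < ⊤ := by
    rw [← eLpNorm_two_sq]
    exact ENNReal.pow_lt_top (hb.restrict _).eLpNorm_lt_top
  have h2 := (lintegral_prod_mul_comp_smul_le hb.aestronglyMeasurable l).trans_lt h1
  rw [← lintegral_prod (fun p : Plane × ℝ => ‖p.2 * b (p.2 • p.1)‖ₑ ^ 2)
    (hGm.enorm.pow_const 2), ← eLpNorm_two_sq] at h2
  exact lt_of_not_ge fun h => by
    rw [top_le_iff.1 h] at h2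
    exact absurd h2 (by simp)

lemma integrable_prod_mul_comp_smul {b : Plane → ℝ} (hb : MemLp b 2 volume) (l : ℝ) :
    Integrable (fun p : Plane × ℝ => p.2 * b (p.2 • p.1))
      ((volume.restrict (Metric.closedBall 0 l)).prod (volume.restrict (Ioc (0 : ℝ) 1))) := by
  have hfin : IsFiniteMeasure (volume.restrict (Metric.closedBall (0 : Plane) l)) :=
    ⟨by simpa using ((isCompact_closedBall (0 : Plane) l).measure_lt_top (μ := volume))⟩
  exact (memLp_prod_mul_comp_smul hb l).integrable one_le_two

lemma aestronglyMeasurable_radialMean {b : Plane → ℝ} (hb : AEStronglyMeasurable b volume) :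
    AEStronglyMeasurable (radialMean b) volume :=
  (aestronglyMeasurable_mul_comp_smul hb volume Measure.AbsolutelyContinuous.rfl).integral_prod_right'

/-- Cauchy–Schwarz in `s` reduces this to the kernel bound. The weight `s` inherited from `A₀` is
what offsets the concentration of `b(sx)` near `s = 0`. -/
lemma lintegral_radialMean_sq_le {b : Plane → ℝ} (hb : AEStronglyMeasurable b volume) (l : ℝ) :
    ∫⁻ x in Metric.closedBall 0 l, ‖radialMean b x‖ₑ ^ 2 ≤
      ∫⁻ x in Metric.closedBall 0 l, ‖b x‖ₑ ^ 2 := by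
  refine le_trans (lintegral_mono_ae ?_) (lintegral_prod_mul_comp_smul_le hb l)
  filter_upwards [(aestronglyMeasurable_mul_comp_smul hb
    (volume.restrict (Metric.closedBall (0 : Plane) l))
    Measure.absolutelyContinuous_restrict).prodMk_left] with x hx
  calc ‖radialMean b x‖ₑ ^ 2 ≤ (∫⁻ s in Ioc (0 : ℝ) 1, ‖s * b (s • x)‖ₑ) ^ 2 := by
        gcongr
        exact enorm_integral_le_lintegral_enorm _
    _ ≤ _ := lintegral_sq_le (by simp) hx.enorm

lemma abs_two_mul_canonicalPotential_le (x : Plane) (k : Fin 2) :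
    |2 * canonicalPotential x k| ≤ ‖x‖ := by
  have h1 : |x 0| ≤ ‖x‖ := PiLp.norm_apply_le x 0
  have h2 : |x 1| ≤ ‖x‖ := PiLp.norm_apply_le x 1
  fin_cases k
  · simpa [canonicalPotential] using h2
  · simpa [canonicalPotential] using h1

lemma continuous_canonicalPotential_apply (k : Fin 2) :
    Continuous (fun x : Plane => canonicalPotential x k) := by
  fin_cases k <;> simp [canonicalPotential] <;> fun_prop

lemma aestronglyMeasurable_radialPotential {b : Plane → ℝ} (hb : AEStronglyMeasurable b volume)
    (k : Fin 2) : AEStronglyMeasurable (radialPotential b k) volume :=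
  (aestronglyMeasurable_radialMean hb).mul
    ((continuous_canonicalPotential_apply k).const_mul 2).aestronglyMeasurable

/-- The potential generated by `b` is small in `L²` on small balls. -/
lemma lintegral_radialPotential_sq_le {b : Plane → ℝ} (hb : AEStronglyMeasurable b volume)
    {l : ℝ} (hl : 0 ≤ l) (k : Fin 2) :
    ∫⁻ x in Metric.closedBall 0 l, ‖radialPotential b k x‖ₑ ^ 2 ≤
      ENNReal.ofReal (l ^ 2) * ∫⁻ x in Metric.closedBall 0 l, ‖b x‖ₑ ^ 2 := by
  calc _ ≤ ∫⁻ x in Metric.closedBall 0 l, ENNReal.ofReal (l ^ 2) * ‖radialMean b x‖ₑ ^ 2 := by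
        refine setLIntegral_mono' Metric.isClosed_closedBall.measurableSet fun x hx => ?_
        rw [radialPotential, enorm_mul, mul_pow, mul_comm, ENNReal.ofReal_pow hl]
        gcongr
        rw [← ofReal_norm, Real.norm_eq_abs]
        exact ENNReal.ofReal_le_ofReal ((abs_two_mul_canonicalPotential_le x k).trans
          (mem_closedBall_zero_iff.1 hx))
    _ ≤ _ := by
        rw [lintegral_const_mul' _ _ ENNReal.ofReal_ne_top]
        exact mul_le_mul' le_rfl (lintegral_radialMean_sq_le hb l)

lemma memLp_radialPotential {b : Plane → ℝ} (hb : MemLp b 2 volume) {S : Set Plane}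
    (hS : Bornology.IsBounded S) (k : Fin 2) :
    MemLp (radialPotential b k) 2 (volume.restrict S) := by
  obtain ⟨l, hl, hSl⟩ := hS.subset_closedBall_lt 0 0
  refine MemLp.mono_measure (Measure.restrict_mono_set _ hSl)
    ⟨(aestronglyMeasurable_radialPotential hb.aestronglyMeasurable k).restrict, ?_⟩
  have h1 : ∫⁻ x in Metric.closedBall 0 l, ‖b x‖ₑ ^ 2 < ⊤ := by
    rw [← eLpNorm_two_sq]
    exact ENNReal.pow_lt_top (hb.restrict _).eLpNorm_lt_top
  have h2 := (lintegral_radialPotential_sq_le hb.aestronglyMeasurable hl.le k).trans_lt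
    (ENNReal.mul_lt_top ENNReal.ofReal_lt_top h1)
  rw [← eLpNorm_two_sq] at h2
  exact lt_of_not_ge fun h => by
    rw [top_le_iff.1 h] at h2
    exact absurd h2 (by simp)

/-- Subtracting a constant from `b` subtracts a constant multiple of the canonical potential. -/
lemma ae_radialPotential_sub_const {b : Plane → ℝ} (hb : MemLp b 2 volume) (k l : ℝ) :
    ∀ᵐ x ∂(volume.restrict (Metric.closedBall (0 : Plane) l)), ∀ j,
      radialPotential (fun y => b y - k) j x =
        radialPotential b j x - k * canonicalPotential x j := by
  -- Fubini gives integrability of `s ↦ s b(sx)` only for almost every `x`, hence the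
  -- almost-everywhere conclusion.
  filter_upwards [(integrable_prod_mul_comp_smul hb l).prod_right_ae] with x hx j
  have h1 : ∫ s in Ioc (0 : ℝ) 1, s = 1 / 2 := by
    rw [← intervalIntegral.integral_of_le zero_le_one]
    simp
  have h2 : IntegrableOn (fun s : ℝ => s * k) (Ioc 0 1) :=
    (Continuous.integrableOn_Icc (by fun_prop)).mono_set Ioc_subset_Icc_self
  have : radialMean (fun y => b y - k) x = radialMean b x - k / 2 := by
    simp only [radialMean, mul_sub]
    rw [integral_sub hx h2, integral_mul_const, h1]
    ring
  rw [radialPotential, this, radialPotential]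
  ring

/-! ### The weak curl of the radial potential -/

lemma plane_eq_sum (x : Plane) : x = x 0 • stdVec 0 + x 1 • stdVec 1 := by
  ext k
  fin_cases k <;> simp [stdVec]

lemma clm_apply_eq {F : Type*} [NormedAddCommGroup F] [NormedSpace ℝ F] (L : Plane →L[ℝ] F)
    (x : Plane) : L x = x 0 • L (stdVec 0) + x 1 • L (stdVec 1) := by
  conv_lhs => rw [plane_eq_sum x]
  simp

/-- The radial derivative of a test function integrates back to the test function. -/
lemma integral_inv_mul_fderiv_radial {φ : Plane → ℝ} (hφ : ContDiff ℝ ∞ φ)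
    (hc : HasCompactSupport φ) {y : Plane} (hy : y ≠ 0)
    (hint : IntegrableOn (fun s : ℝ => s⁻¹ * fderiv ℝ φ (s⁻¹ • y) (s⁻¹ • y)) (Ioc 0 1)) :
    ∫ s in Ioc (0 : ℝ) 1, s⁻¹ * fderiv ℝ φ (s⁻¹ • y) (s⁻¹ • y) = - φ y := by
  obtain ⟨R, hR, hsub⟩ := hc.isCompact.isBounded.subset_closedBall_lt 0 0
  -- Near `s = 0` the point `s⁻¹ y` has left the support of `φ`, so the limit is `0`. It must be
  -- prescribed, since `0⁻¹ = 0` would yield `φ 0`.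
  set F : ℝ → ℝ := fun s => if s = 0 then 0 else φ (s⁻¹ • y) with hF
  have hder : ∀ s : ℝ, 0 < s →
      HasDerivAt F (-(s⁻¹ * fderiv ℝ φ (s⁻¹ • y) (s⁻¹ • y))) s := by
    intro s hs
    have h1 : HasDerivAt (fun s : ℝ => s⁻¹ • y) ((-(s ^ 2)⁻¹) • y) s :=
      (hasDerivAt_inv hs.ne').smul_const y
    have h2 := ((hφ.differentiable (by simp)) (s⁻¹ • y)).hasFDerivAt.comp_hasDerivAt s h1
    refine (h2.congr_of_eventuallyEq ?_).congr_deriv ?_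
    · filter_upwards [lt_mem_nhds hs] with t ht
      simp [hF, ht.ne']
    · simp only [map_smul, smul_eq_mul]
      field_simp
  have hcont : ContinuousOn F (Icc 0 1) := by
    intro s hs
    rcases hs.1.eq_or_lt with rfl | h
    · have hnear : F =ᶠ[nhds 0] fun _ => 0 := by
        have hpos : 0 < ‖y‖ / R := div_pos (norm_pos_iff.2 hy) hR
        filter_upwards [Metric.ball_mem_nhds (0 : ℝ) hpos] with s hs
        by_cases h0 : s = 0
        · simp [hF, h0]
        · simp only [hF, h0, if_false]
          refine image_eq_zero_of_notMem_tsupport fun hmem => ?_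
          have h1 := mem_closedBall_zero_iff.1 (hsub hmem)
          rw [norm_smul, norm_inv, inv_mul_le_iff₀ (norm_pos_iff.2 h0)] at h1
          rw [mem_ball_zero_iff, lt_div_iff₀ hR] at hs
          linarith
      exact (hnear.continuousAt).continuousWithinAt
    · exact (hder s h).continuousAt.continuousWithinAt
  have h := intervalIntegral.integral_eq_sub_of_hasDerivAt_of_le zero_le_one hcont
    (fun s hs => hder s hs.1)
    ((intervalIntegrable_iff_integrableOn_Ioc_of_le zero_le_one).2 hint.neg)
  rw [intervalIntegral.integral_of_le zero_le_one, integral_neg] at h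
  rw [show F 1 = φ y by simp [hF], show F 0 = 0 by simp [hF]] at h
  linarith

/-- `curl` of the potential generated by `b ∈ L²` is `b`. -/
lemma integral_radialPotential {b : Plane → ℝ} (hb : MemLp b 2 volume) {φ : Plane → ℝ}
    (hφ : ContDiff ℝ ∞ φ) (hc : HasCompactSupport φ) :
    ∫ x, (fderiv ℝ φ x (stdVec 0) * radialPotential b 1 x -
      fderiv ℝ φ x (stdVec 1) * radialPotential b 0 x) = - ∫ x, φ x * b x := by
  set D : Plane → ℝ := fun x => fderiv ℝ φ x x with hD
  have hDc : Continuous D := (hφ.continuous_fderiv (by simp)).clm_apply continuous_id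
  have hDs : tsupport D ⊆ tsupport φ := (closure_mono fun x hx => by
    contrapose! hx
    simp only [Function.mem_support, not_not] at hx ⊢
    simp [hD, hx]).trans (tsupport_fderiv_subset ℝ)
  have hDcs : HasCompactSupport D := hc.of_isClosed_subset isClosed_closure hDs
  obtain ⟨K, hK⟩ := hDc.bounded_above_of_compact_support hDcs
  obtain ⟨l, hl, hsub⟩ := hc.isCompact.isBounded.subset_closedBall_lt 0 0
  set S : Set Plane := Metric.closedBall 0 l with hS
  have hD0 : ∀ x ∉ S, D x = 0 := fun x hx =>
    image_eq_zero_of_notMem_tsupport fun h => hx (hsub (hDs h))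
  set I : Set ℝ := Ioc 0 1 with hI
  have hG : Integrable (fun p : Plane × ℝ => p.2 * b (p.2 • p.1) * D p.1)
      ((volume.restrict S).prod (volume.restrict I)) :=
    (integrable_prod_mul_comp_smul hb l).mul_bdd (c := K) (hDc.comp continuous_fst).aestronglyMeasurable
      (Eventually.of_forall fun p => hK _)
  -- The substitution `y = s x`, stated for a general `N` so that it serves both for the integral
  -- (`id`) and for its absolute integrability (`norm`).
  have hscale : ∀ s ∈ I, ∀ N : ℝ → ℝ, N 0 = 0 → ∫ x in S, N (s * b (s • x) * D x) =
      (s ^ 2)⁻¹ * ∫ y, N (s * b y * D (s⁻¹ • y)) := by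
    intro s hs N hN
    rw [setIntegral_eq_integral_of_forall_compl_eq_zero fun x hx => by simp [hD0 x hx, hN]]
    have := Measure.integral_comp_smul_of_nonneg (volume : Measure Plane)
      (fun y => N (s * b y * D (s⁻¹ • y))) s (hR := hs.1.le)
    simp only [inv_smul_smul₀ hs.1.ne', finrank_euclideanSpace, Fintype.card_fin, smul_eq_mul]
      at this
    exact this
  have hH : Integrable (fun p : ℝ × Plane => b p.2 * (p.1⁻¹ * D (p.1⁻¹ • p.2)))
      ((volume.restrict I).prod volume) := by
    have hm : AEStronglyMeasurable (fun p : ℝ × Plane => b p.2 * (p.1⁻¹ * D (p.1⁻¹ • p.2)))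
        ((volume.restrict I).prod volume) := by
      refine hb.aestronglyMeasurable.comp_snd.mul (Measurable.aestronglyMeasurable ?_)
      exact measurable_fst.inv.mul (hDc.measurable.comp (measurable_fst.inv.smul measurable_snd))
    refine (integrable_prod_iff hm).2 ⟨?_, ?_⟩
    · filter_upwards [ae_restrict_mem measurableSet_Ioc] with s hs
      have hDsc : HasCompactSupport fun y : Plane => D (s⁻¹ • y) :=
        hDcs.comp_homeomorph (Homeomorph.smulOfNeZero s⁻¹ (inv_ne_zero hs.1.ne'))
      have hDL : MemLp (fun y : Plane => s⁻¹ * D (s⁻¹ • y)) 2 volume :=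
        ((hDc.comp (continuous_const_smul s⁻¹)).memLp_of_hasCompactSupport hDsc).const_mul s⁻¹
      exact hb.integrable_mul hDL
    · refine (hG.swap.integral_norm_prod_left).congr ?_
      filter_upwards [ae_restrict_mem measurableSet_Ioc] with s hs
      simp only [Function.comp_apply, Prod.swap_prod_mk]
      rw [hscale s hs norm norm_zero, ← integral_const_mul]
      refine integral_congr_ae (Eventually.of_forall fun y => ?_)
      simp only [norm_mul, norm_inv, Real.norm_of_nonneg hs.1.le]
      have := hs.1.ne'
      field_simp
  -- The potential is `radialMean b` times the rotated position vector, so pairing it with the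
  -- rotated gradient of `φ` leaves the Euler derivative `D x = x · ∇φ(x)`.
  have hL : ∫ x, (fderiv ℝ φ x (stdVec 0) * radialPotential b 1 x -
      fderiv ℝ φ x (stdVec 1) * radialPotential b 0 x) = ∫ x in S, radialMean b x * D x := by
    rw [setIntegral_eq_integral_of_forall_compl_eq_zero fun x hx => by simp [hD0 x hx]]
    congr 1 with x
    simp only [hD]
    rw [clm_apply_eq (fderiv ℝ φ x) x]
    simp [radialPotential, canonicalPotential]
    ring
  rw [hL]
  calc ∫ x in S, radialMean b x * D x
      = ∫ x in S, ∫ s in I, s * b (s • x) * D x := by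
        simp only [radialMean, ← integral_mul_const, hI]
    _ = ∫ s in I, ∫ x in S, s * b (s • x) * D x := integral_integral_swap hG
    _ = ∫ s in I, ∫ y, b y * (s⁻¹ * D (s⁻¹ • y)) := by
        refine setIntegral_congr_fun measurableSet_Ioc fun s hs => ?_
        refine (hscale s hs id rfl).trans ?_
        rw [← integral_const_mul]
        congr 1 with y
        have := hs.1.ne'
        simp only [id]
        field_simp
    _ = ∫ y, ∫ s in I, b y * (s⁻¹ * D (s⁻¹ • y)) := integral_integral_swap hH
    _ = ∫ y, - (φ y * b y) := by
        refine integral_congr_ae ?_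
        have hne : ∀ᵐ y : Plane, y ≠ 0 := by simp [ae_iff]
        filter_upwards [hH.swap.prod_right_ae, hne] with y hy hy0
        -- Integrability of the slice is known only after multiplication by `b y`; where `b y = 0`
        -- both sides vanish.
        by_cases hby : b y = 0
        · simp [hby]
        · have hi : IntegrableOn (fun s : ℝ => s⁻¹ * D (s⁻¹ • y)) I := by
            have := hy.const_mul (b y)⁻¹
            simpa [IntegrableOn, hby] using this
          rw [integral_const_mul, integral_inv_mul_fderiv_radial hφ hc hy0 hi]
          ring
    _ = _ := integral_neg _

/-! ### Mollification in `L²` -/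

open scoped Convolution in
/-- The mollification of `f` by a normalized bump function. -/
def mollify (ρ : ContDiffBump (0 : Plane)) (f : Plane → ℝ) : Plane → ℝ :=
  ρ.normed volume ⋆[ContinuousLinearMap.lsmul ℝ ℝ, volume] f

lemma mollify_apply (ρ : ContDiffBump (0 : Plane)) (f : Plane → ℝ) (x : Plane) :
    mollify ρ f x = ∫ t, ρ.normed volume t * f (x - t) := rfl

lemma contDiff_mollify (ρ : ContDiffBump (0 : Plane)) {f : Plane → ℝ}
    (hf : LocallyIntegrable f volume) : ContDiff ℝ ∞ (mollify ρ f) :=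
  ρ.hasCompactSupport_normed.contDiff_convolution_left _ ρ.contDiff_normed hf

/-- The normalized bump is the density of a probability measure, so Cauchy–Schwarz bounds the square
of the average by the average of the squares; Tonelli and translation invariance finish. -/
lemma eLpNorm_mollify_le (ρ : ContDiffBump (0 : Plane)) {f : Plane → ℝ}
    (hf : AEStronglyMeasurable f volume) :
    eLpNorm (mollify ρ f) 2 volume ≤ eLpNorm f 2 volume := by
  set ν : Measure Plane := volume.withDensity fun t => ‖ρ.normed volume t‖ₑ with hν
  have hρm : Measurable fun t : Plane => ‖ρ.normed volume t‖ₑ :=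
    (ρ.contDiff_normed (n := ⊤)).continuous.measurable.enorm
  have hν1 : ν univ = 1 := by
    rw [hν, withDensity_apply _ MeasurableSet.univ, setLIntegral_univ]
    have : ∀ t : Plane, ‖ρ.normed volume t‖ₑ = ENNReal.ofReal (ρ.normed volume t) := fun t =>
      Real.enorm_of_nonneg (ρ.nonneg_normed t)
    simp only [this]
    rw [← ofReal_integral_eq_lintegral_ofReal ρ.integrable_normed
      (Eventually.of_forall ρ.nonneg_normed), ρ.integral_normed, ENNReal.ofReal_one]
  have hfin : IsFiniteMeasure ν := ⟨by rw [hν1]; exact ENNReal.one_lt_top⟩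
  have hac : ν ≪ volume := withDensity_absolutelyContinuous _ _
  have hm : AEStronglyMeasurable (fun p : Plane × Plane => f (p.1 - p.2)) (volume.prod ν) := by
    refine hf.comp_quasiMeasurePreserving (QuasiMeasurePreserving.prod_of_left (by fun_prop) ?_)
    exact Eventually.of_forall fun t => (measurePreserving_sub_right volume t).quasiMeasurePreserving
  have key : eLpNorm (mollify ρ f) 2 volume ^ 2 ≤ eLpNorm f 2 volume ^ 2 := by
    rw [eLpNorm_two_sq, eLpNorm_two_sq]
    calc ∫⁻ x, ‖mollify ρ f x‖ₑ ^ 2 ≤ ∫⁻ x, ∫⁻ t, ‖f (x - t)‖ₑ ^ 2 ∂ν := by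
          refine lintegral_mono_ae ?_
          filter_upwards [hm.prodMk_left] with x hx
          refine le_trans ?_ (lintegral_sq_le hν1.le hx.enorm)
          gcongr
          rw [mollify_apply]
          refine (enorm_integral_le_lintegral_enorm _).trans (le_of_eq ?_)
          rw [hν, lintegral_withDensity_eq_lintegral_mul_non_measurable _ hρm
            (Eventually.of_forall fun t => by simp)]
          simp [enorm_mul]
      _ = ∫⁻ t, (∫⁻ x, ‖f (x - t)‖ₑ ^ 2) ∂ν :=
          lintegral_lintegral_swap (hm.enorm.pow_const 2)
      _ = ∫⁻ x, ‖f x‖ₑ ^ 2 := by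
          simp [lintegral_sub_right_eq_self (fun x => ‖f x‖ₑ ^ 2), hν1]
  exact (ENNReal.pow_le_pow_left_iff two_ne_zero).1 key

/-- Mollifications of `f ∈ L²` converge to `f` in `L²` on sets of finite measure. -/
lemma exists_forall_eLpNorm_mollify_sub_le {f : Plane → ℝ} (hf : MemLp f 2 volume) {S : Set Plane}
    (hS : volume S ≠ ⊤) {ε : ℝ≥0∞} (hε : ε ≠ 0) : ∃ δ : ℝ, 0 < δ ∧
      ∀ ρ : ContDiffBump (0 : Plane), ρ.rOut ≤ δ →
        eLpNorm (mollify ρ f - f) 2 (volume.restrict S) ≤ ε := by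
  have hε3 : ε / 3 ≠ 0 := (ENNReal.div_pos hε (by simp)).ne'
  obtain ⟨g, hgc, hfg, hgcont, hgL⟩ := hf.exists_hasCompactSupport_eLpNorm_sub_le (by simp) hε3
  -- `η` is a uniform error for the continuous approximant `g`, small enough that its `L²` norm over
  -- `S`, of finite measure, is at most `ε / 3`.
  obtain ⟨η, hη, hηle⟩ : ∃ η : ℝ, 0 < η ∧
      (volume.restrict S) univ ^ (2 : ℝ≥0∞).toReal⁻¹ * ENNReal.ofReal η ≤ ε / 3 := by
    have ht : Tendsto (fun η : ℝ => (volume.restrict S) univ ^ (2 : ℝ≥0∞).toReal⁻¹ *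
        ENNReal.ofReal η) (nhdsWithin 0 (Ioi 0)) (nhds 0) := by
      have h1 : Tendsto (fun η : ℝ => ENNReal.ofReal η) (nhdsWithin 0 (Ioi 0)) (nhds 0) := by
        have := (ENNReal.continuous_ofReal.tendsto 0).mono_left
          (nhdsWithin_le_nhds (s := Ioi (0 : ℝ)))
        simpa using this
      have := ENNReal.Tendsto.const_mul (a := (volume.restrict S) univ ^ (2 : ℝ≥0∞).toReal⁻¹) h1
        (Or.inr (ENNReal.rpow_ne_top_of_nonneg (by simp) (by simpa using hS)))
      simpa using this
    have h2 := (ht.eventually (gt_mem_nhds (pos_iff_ne_zero.2 hε3))).and self_mem_nhdsWithin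
    obtain ⟨η, h3, h4⟩ := h2.exists
    exact ⟨η, h4, h3.le⟩
  obtain ⟨δ, hδ, hδg⟩ := Metric.uniformContinuous_iff.1
    (hgc.uniformContinuous_of_continuous hgcont) η hη
  refine ⟨δ, hδ, fun ρ hρ => ?_⟩
  have hfl := hf.locallyIntegrable one_le_two
  have hgl := hgL.locallyIntegrable one_le_two
  have hdecomp : mollify ρ f - f = (mollify ρ (f - g) + (mollify ρ g - g)) + (g - f) := by
    have : mollify ρ f = mollify ρ (f - g) + mollify ρ g := by
      have h := (ρ.hasCompactSupport_normed (μ := volume)).convolutionExists_left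
        (ContinuousLinearMap.lsmul ℝ ℝ) (ρ.contDiff_normed (n := 0)).continuous
        (hfl.sub hgl) |>.distrib_add
        ((ρ.hasCompactSupport_normed (μ := volume)).convolutionExists_left
        (ContinuousLinearMap.lsmul ℝ ℝ) (ρ.contDiff_normed (n := 0)).continuous hgl)
      rw [sub_add_cancel] at h
      exact h
    rw [this]
    abel
  have m1 : AEStronglyMeasurable (mollify ρ (f - g)) (volume.restrict S) :=
    (contDiff_mollify ρ (hfl.sub hgl)).continuous.aestronglyMeasurable
  have m2 : AEStronglyMeasurable (mollify ρ g - g) (volume.restrict S) :=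
    ((contDiff_mollify ρ hgl).continuous.sub hgcont).aestronglyMeasurable
  have m3 : AEStronglyMeasurable (g - f) (volume.restrict S) :=
    (hgL.aestronglyMeasurable.sub hf.aestronglyMeasurable).restrict
  have e1 : eLpNorm (mollify ρ (f - g)) 2 (volume.restrict S) ≤ ε / 3 :=
    (eLpNorm_mono_measure _ Measure.restrict_le_self).trans
      ((eLpNorm_mollify_le ρ (hf.sub hgL).aestronglyMeasurable).trans hfg)
  have e2 : eLpNorm (mollify ρ g - g) 2 (volume.restrict S) ≤ ε / 3 := by
    refine (eLpNorm_le_of_ae_bound (C := η) (Eventually.of_forall fun x => ?_)).trans hηle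
    rw [Pi.sub_apply, ← dist_eq_norm]
    exact ρ.dist_normed_convolution_le hgcont.aestronglyMeasurable fun y hy =>
      (hδg ((Metric.mem_ball.1 hy).trans_le hρ)).le
  have e3 : eLpNorm (g - f) 2 (volume.restrict S) ≤ ε / 3 := by
    rw [eLpNorm_sub_comm]
    exact (eLpNorm_mono_measure _ Measure.restrict_le_self).trans hfg
  rw [hdecomp]
  calc _ ≤ eLpNorm (mollify ρ (f - g) + (mollify ρ g - g)) 2 (volume.restrict S) +
        eLpNorm (g - f) 2 (volume.restrict S) := eLpNorm_add_le (m1.add m2) m3 one_le_two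
    _ ≤ (ε / 3 + ε / 3) + ε / 3 :=
        add_le_add ((eLpNorm_add_le m1 m2 one_le_two).trans (add_le_add e1 e2)) e3
    _ = ε := ENNReal.add_thirds ε

lemma fderiv_mollify_apply (ρ : ContDiffBump (0 : Plane)) {f : Plane → ℝ}
    (hf : LocallyIntegrable f volume) (x v : Plane) :
    fderiv ℝ (mollify ρ f) x v = ∫ t, fderiv ℝ (ρ.normed volume) (x - t) v * f t := by
  have hρ := ρ.contDiff_normed (μ := volume) (n := ⊤)
  have hρc := ρ.hasCompactSupport_normed (μ := volume)
  have h := hρc.hasFDerivAt_convolution_left (ContinuousLinearMap.lsmul ℝ ℝ) (hρ.of_le (by simp))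
    hf x
  have hex := (hρc.fderiv (𝕜 := ℝ)).convolutionExists_left
    ((ContinuousLinearMap.lsmul ℝ ℝ).precompL Plane) (hρ.continuous_fderiv (by simp)) hf x
  rw [mollify, h.fderiv, convolution_def, ContinuousLinearMap.integral_apply hex]
  rw [← integral_sub_left_eq_self _ volume x]
  simp [ContinuousLinearMap.precompL_apply]

/-! ### Curl-free fields as limits of gradients -/

/-- Mollifications of weakly curl-free fields are curl-free. -/
lemma fderiv_mollify_symm {Ω : Set Plane} (hΩ : IsOpen Ω) {W : Fin 2 → Plane → ℝ}
    (hW : ∀ k, MemLp (W k) 2 (volume.restrict Ω)) (hcurl : HasWeakCurl Ω W 0)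
    (ρ : ContDiffBump (0 : Plane)) {x : Plane} (hx : Metric.closedBall x ρ.rOut ⊆ Ω) :
    fderiv ℝ (mollify ρ (Ω.indicator (W 1))) x (stdVec 0) =
      fderiv ℝ (mollify ρ (Ω.indicator (W 0))) x (stdVec 1) := by
  have hloc : ∀ k, LocallyIntegrable (Ω.indicator (W k)) volume := fun k =>
    ((memLp_indicator_iff_restrict hΩ.measurableSet).2 (hW k)).locallyIntegrable one_le_two
  have hρ := ρ.contDiff_normed (μ := volume) (n := ⊤)
  -- The weak equation is tested with the reflected kernel centred at `x`; the hypothesis on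
  -- `closedBall x ρ.rOut` makes it admissible.
  set φ : Plane → ℝ := fun y => ρ.normed volume (x - y) with hφ
  have hφs : ContDiff ℝ ∞ φ := hρ.comp (contDiff_const.sub contDiff_id)
  have hts : tsupport φ ⊆ Metric.closedBall x ρ.rOut := by
    refine closure_minimal (fun y hy => ?_) Metric.isClosed_closedBall
    have : x - y ∈ Metric.ball (0 : Plane) ρ.rOut := by
      rw [← ρ.support_normed_eq (μ := volume)]
      exact hy
    rw [mem_ball_zero_iff] at this
    rw [Metric.mem_closedBall, dist_comm, dist_eq_norm]
    exact this.le
  have hφc : HasCompactSupport φ :=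
    (isCompact_closedBall x ρ.rOut).of_isClosed_subset isClosed_closure hts
  have hder : ∀ y v, fderiv ℝ φ y v = - fderiv ℝ (ρ.normed volume) (x - y) v := fun y v => by
    have h1 : HasFDerivAt (fun y : Plane => x - y) (-ContinuousLinearMap.id ℝ Plane) y :=
      (hasFDerivAt_id y).const_sub x
    have h2 := ((hρ.differentiable (by simp) (x - y)).hasFDerivAt.comp y h1).fderiv
    have h3 := congrArg (fun L => L v) h2
    simp only [ContinuousLinearMap.comp_neg, ContinuousLinearMap.comp_id,
      _root_.neg_apply] at h3
    exact h3
  have h := hcurl φ hφs hφc (hts.trans hx)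
  have hDL : ∀ v, MemLp (fun y => fderiv ℝ φ y v) 2 (volume.restrict Ω) := fun v =>
    ((hφs.fderiv_apply_const v).continuous.memLp_of_hasCompactSupport
      (hφc.fderiv_apply_const v)).restrict Ω
  have hDi : ∀ k v, Integrable (fun y => fderiv ℝ φ y v * W k y) (volume.restrict Ω) := fun k v =>
    (hDL v).integrable_mul (hW k)
  rw [integral_sub (hDi 1 _) (hDi 0 _)] at h
  simp only [Pi.zero_apply, mul_zero, integral_zero, neg_zero] at h
  have hrew : ∀ k v, fderiv ℝ (mollify ρ (Ω.indicator (W k))) x v =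
      - ∫ y in Ω, fderiv ℝ φ y v * W k y := fun k v => by
    rw [fderiv_mollify_apply ρ (hloc k), ← integral_neg, ← integral_indicator hΩ.measurableSet]
    congr 1 with y
    by_cases hy : y ∈ Ω <;> simp [hy, hder]
  rw [hrew, hrew]
  linarith

/-- A smooth curl-free field on an open convex set is a gradient. -/
lemma exists_contDiffOn_fderiv_eq {s : Set Plane} (hs : Convex ℝ s) (hso : IsOpen s)
    {V : Fin 2 → Plane → ℝ} (hV : ∀ k, ContDiff ℝ ∞ (V k))
    (hcurl : ∀ x ∈ s, fderiv ℝ (V 1) x (stdVec 0) = fderiv ℝ (V 0) x (stdVec 1)) :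
    ∃ θ : Plane → ℝ, ContDiffOn ℝ ∞ θ s ∧ ∀ x ∈ s, ∀ k, fderiv ℝ θ x (stdVec k) = V k x := by
  set p : Fin 2 → Plane →L[ℝ] ℝ := fun k => EuclideanSpace.proj k with hp
  -- The one-form `V₀ dx₀ + V₁ dx₁` is closed, i.e. has symmetric derivative, so the Poincaré lemma
  -- on the convex set `s` applies.
  set η : Plane → Plane →L[ℝ] ℝ := fun x => V 0 x • p 0 + V 1 x • p 1 with hη
  have hηs : ContDiff ℝ ∞ η := ((hV 0).smul contDiff_const).add ((hV 1).smul contDiff_const)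
  have hd : ∀ k, Differentiable ℝ (V k) := fun k => (hV k).differentiable (by simp)
  have hfd : ∀ x v w, fderiv ℝ η x v w = fderiv ℝ (V 0) x v * w 0 + fderiv ℝ (V 1) x v * w 1 := by
    intro x v w
    have h0 := (hd 0 x).hasFDerivAt.smul_const (p 0)
    have h1 := (hd 1 x).hasFDerivAt.smul_const (p 1)
    have h2 : HasFDerivAt η _ x := h0.add h1
    rw [h2.fderiv]
    simp [hp]
  obtain ⟨θ, hθ⟩ := hs.exists_forall_hasFDerivAt_of_fderiv_symmetric hso
    (hηs.differentiable (by simp)).differentiableOn (fun a ha x y => by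
      rw [hfd, hfd, clm_apply_eq (fderiv ℝ (V 0) a) x, clm_apply_eq (fderiv ℝ (V 1) a) x,
        clm_apply_eq (fderiv ℝ (V 0) a) y, clm_apply_eq (fderiv ℝ (V 1) a) y, hcurl a ha]
      simp only [smul_eq_mul]
      ring)
  refine ⟨θ, ?_, fun x hx k => ?_⟩
  · rw [contDiffOn_infty_iff_fderiv_of_isOpen hso]
    refine ⟨fun x hx => (hθ x hx).differentiableAt.differentiableWithinAt, ?_⟩
    exact hηs.contDiffOn.congr fun x hx => (hθ x hx).fderiv
  · rw [(hθ x hx).fderiv]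
    fin_cases k <;> simp [hη, hp, stdVec]

/-- Weakly curl-free fields on a ball are `L²`-limits of smooth gradients. -/
lemma exists_gradient_approx {Ω : Set Plane} (hΩ : IsOpen Ω) {W : Fin 2 → Plane → ℝ}
    (hW : ∀ k, MemLp (W k) 2 (volume.restrict Ω)) (hcurl : HasWeakCurl Ω W 0) {c : Plane}
    {r R : ℝ} (hrR : r < R) (hR : Metric.ball c R ⊆ Ω) {ε : ℝ≥0∞} (hε : ε ≠ 0) :
    ∃ θ : Plane → ℝ, ContDiffOn ℝ ∞ θ (Metric.ball c r) ∧
      ∀ k, eLpNorm (fun x => W k x - fderiv ℝ θ x (stdVec k)) 2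
        (volume.restrict (Metric.ball c r)) ≤ ε := by
  have hL : ∀ k, MemLp (Ω.indicator (W k)) 2 volume := fun k =>
    (memLp_indicator_iff_restrict hΩ.measurableSet).2 (hW k)
  choose δ hδ hδle using fun k => exists_forall_eLpNorm_mollify_sub_le (hL k)
    (S := Metric.ball c r) (Metric.isBounded_ball.measure_lt_top.ne) hε
  -- The radius serves both components and keeps the kernel centred at any point of the `r`-ball
  -- inside the `R`-ball.
  set d : ℝ := min (min (δ 0) (δ 1)) ((R - r) / 2) with hd
  have hdpos : 0 < d := lt_min (lt_min (hδ 0) (hδ 1)) (by linarith)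
  let ρ : ContDiffBump (0 : Plane) := ⟨d / 2, d, by linarith, by linarith⟩
  have hdk : ∀ k, ρ.rOut ≤ δ k := fun k => by
    fin_cases k
    · exact (min_le_left _ _).trans (min_le_left _ _)
    · exact (min_le_left _ _).trans (min_le_right _ _)
  have hdr : d ≤ (R - r) / 2 := min_le_right _ _
  obtain ⟨θ, hθ, hθd⟩ := exists_contDiffOn_fderiv_eq (convex_ball c r) Metric.isOpen_ball
    (V := fun k => mollify ρ (Ω.indicator (W k)))
    (fun k => contDiff_mollify ρ ((hL k).locallyIntegrable one_le_two)) (fun x hx => by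
      refine fderiv_mollify_symm hΩ hW hcurl ρ fun y hy => hR ?_
      rw [Metric.mem_ball] at hx ⊢
      have h1 : dist y x ≤ d := hy
      linarith [dist_triangle y x c])
  refine ⟨θ, hθ, fun k => ?_⟩
  rw [← eLpNorm_neg]
  refine le_trans (le_of_eq (eLpNorm_congr_ae ?_)) (hδle k ρ (hdk k))
  filter_upwards [ae_restrict_mem Metric.isOpen_ball.measurableSet] with x hx
  have hrx : x ∈ Ω := hR (Metric.ball_subset_ball hrR.le hx)
  simp [hθd x hx k, hrx]

/-! ### Gaussian trial functions in a constant field -/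

lemma integrable_exp_neg_mul_norm_sq {b : ℝ} (hb : 0 < b) :
    Integrable (fun x : Plane => Real.exp (-(b * ‖x‖ ^ 2))) := by
  have h := (GaussianFourier.integrable_cexp_neg_mul_sq_norm_add (V := Plane) (b := (b : ℂ))
    (by simpa using hb) 0 0).norm
  refine h.congr (Eventually.of_forall fun x => ?_)
  simp only [Complex.norm_exp]
  congr 1
  simp [← Complex.ofReal_pow]

lemma fderiv_coord_apply (j : Fin 2) (x v : Plane) :
    fderiv ℝ (fun y : Plane => y j) x v = v j := by
  have : HasFDerivAt (fun y : Plane => y j) (EuclideanSpace.proj j : Plane →L[ℝ] ℝ) x :=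
    (EuclideanSpace.proj j : Plane →L[ℝ] ℝ).hasFDerivAt
  rw [this.fderiv]
  simp

lemma contDiff_coord (j : Fin 2) : ContDiff ℝ ∞ (fun y : Plane => y j) :=
  (EuclideanSpace.proj j : Plane →L[ℝ] ℝ).contDiff

lemma stdVec_apply_self (j : Fin 2) : stdVec j j = 1 := by simp [stdVec]

/-- The Gaussian density of the lowest Landau level. -/
def landauGaussian (k : ℝ) (x : Plane) : ℝ := Real.exp (-(k / 4 * ‖x‖ ^ 2))

lemma contDiff_landauGaussian (k : ℝ) : ContDiff ℝ ∞ (landauGaussian k) :=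
  Real.contDiff_exp.comp (contDiff_const.mul (contDiff_norm_sq ℝ)).neg

lemma fderiv_landauGaussian (k : ℝ) (x : Plane) (j : Fin 2) :
    fderiv ℝ (landauGaussian k) x (stdVec j) = -(k / 2 * x j * landauGaussian k x) := by
  have h1 : HasFDerivAt (fun y : Plane => ‖y‖ ^ 2) _ x := (hasStrictFDerivAt_norm_sq x).hasFDerivAt
  have h2 : HasFDerivAt (landauGaussian k) _ x := (h1.const_mul (k / 4)).neg.exp
  rw [h2.fderiv]
  simp [landauGaussian, stdVec, EuclideanSpace.inner_single_right]
  ring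

lemma Continuous.integrable_sq_of_hasCompactSupport {f : Plane → ℝ} (hf : Continuous f)
    (hc : HasCompactSupport f) : Integrable fun x => f x ^ 2 :=
  (hf.memLp_of_hasCompactSupport (p := 2) (μ := volume) hc).integrable_sq

/-- For a cut-off Gaussian the energy in a constant magnetic field localizes. -/
lemma integral_energy_mul_landauGaussian (k : ℝ) {χ : Plane → ℝ} (hχ : ContDiff ℝ ∞ χ)
    (hc : HasCompactSupport χ) {f : Plane → ℝ} (hf : f = fun x => χ x * landauGaussian k x) :
    ∫ x, ∑ j, (fderiv ℝ f x (stdVec j) ^ 2 + (k * canonicalPotential x j * f x) ^ 2) =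
      (∫ x, landauGaussian k x ^ 2 * ∑ j, fderiv ℝ χ x (stdVec j) ^ 2) + k * ∫ x, f x ^ 2 := by
  have hψ := contDiff_landauGaussian k
  have hfs : ContDiff ℝ ∞ f := by rw [hf]; exact hχ.mul hψ
  have hfc : HasCompactSupport f := by rw [hf]; exact hc.mul_right
  have hh : ∀ j : Fin 2, ContDiff ℝ ∞ (fun y : Plane => y j * (f y * f y)) := fun j =>
    (contDiff_coord j).mul (hfs.mul hfs)
  have hhc : ∀ j : Fin 2, HasCompactSupport (fun y : Plane => y j * (f y * f y)) := fun j =>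
    (hfc.mul_right (f' := f)).mul_left
  have hz := fun j => integral_fderiv_eq_zero_of_hasCompactSupport (hh j) (hhc j) (stdVec j)
  have hzi : ∀ j, Integrable fun x =>
      fderiv ℝ (fun y : Plane => y j * (f y * f y)) x (stdVec j) := fun j =>
    ((hh j).fderiv_apply_const _).continuous.integrable_of_hasCompactSupport
      ((hhc j).fderiv_apply_const _)
  have hfi : Integrable fun x => f x ^ 2 :=
    hfs.continuous.integrable_sq_of_hasCompactSupport hfc
  -- With `ψ = landauGaussian k` one has `∇ψ = -(k/2) x ψ`, so the energy density is `ψ² |∇χ|² + k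
  -- f²` minus `k/2` times the divergence of `x f²`, which integrates to zero.
  have hpt : ∀ x, ∑ j, (fderiv ℝ f x (stdVec j) ^ 2 + (k * canonicalPotential x j * f x) ^ 2) =
      landauGaussian k x ^ 2 * ∑ j, fderiv ℝ χ x (stdVec j) ^ 2 + k * f x ^ 2 -
      k / 2 * ∑ j, fderiv ℝ (fun y : Plane => y j * (f y * f y)) x (stdVec j) := by
    intro x
    have hfd : DifferentiableAt ℝ f x := hfs.differentiable (by simp) x
    have hχd : DifferentiableAt ℝ χ x := hχ.differentiable (by simp) x
    have hψd : DifferentiableAt ℝ (landauGaussian k) x := hψ.differentiable (by simp) x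
    have h1 : ∀ j, fderiv ℝ f x (stdVec j) = landauGaussian k x * fderiv ℝ χ x (stdVec j) -
        k / 2 * x j * f x := fun j => by
      rw [hf, fderiv_fun_mul hχd hψd]
      simp only [_root_.add_apply, _root_.smul_apply, smul_eq_mul, fderiv_landauGaussian]
      ring
    have h2 : ∀ j : Fin 2, fderiv ℝ (fun y : Plane => y j * (f y * f y)) x (stdVec j) =
        f x ^ 2 + 2 * x j * f x * fderiv ℝ f x (stdVec j) := fun j => by
      rw [fderiv_fun_mul ((contDiff_coord j).differentiable (by simp) x) (hfd.fun_mul hfd),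
        fderiv_fun_mul hfd hfd]
      simp only [_root_.add_apply, _root_.smul_apply, smul_eq_mul, fderiv_coord_apply,
        stdVec_apply_self]
      ring
    simp only [h2, h1, Fin.sum_univ_two, canonicalPotential]
    simp [hf]
    ring
  have hχi : Integrable fun x => landauGaussian k x ^ 2 * ∑ j, fderiv ℝ χ x (stdVec j) ^ 2 := by
    simp only [Finset.mul_sum]
    refine integrable_finsetSum _ fun j _ => ?_
    simp only [← mul_pow]
    exact (hψ.continuous.mul (hχ.fderiv_apply_const _).continuous).integrable_sq_of_hasCompactSupport
      (hc.fderiv_apply_const (stdVec j)).mul_left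
  simp only [hpt]
  have hadd : Integrable fun x => landauGaussian k x ^ 2 * ∑ j, fderiv ℝ χ x (stdVec j) ^ 2 +
      k * f x ^ 2 := hχi.add (hfi.const_mul k)
  rw [integral_sub hadd ((integrable_finsetSum _ fun j _ => hzi j).const_mul _),
    integral_add hχi (hfi.const_mul k), integral_const_mul, integral_const_mul,
    integral_finsetSum _ fun j _ => hzi j]
  simp [hz]

/-- Compactly supported functions whose energy in the constant magnetic field `k` is nearly `k`. -/
lemma exists_energy_le {k : ℝ} (hk : 0 < k) {ε : ℝ} (hε : 0 < ε) :
    ∃ f : Plane → ℝ, ContDiff ℝ ∞ f ∧ HasCompactSupport f ∧ 0 < ∫ x, f x ^ 2 ∧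
      ∫ x, ∑ j, (fderiv ℝ f x (stdVec j) ^ 2 + (k * canonicalPotential x j * f x) ^ 2) ≤
        (k + ε) * ∫ x, f x ^ 2 := by
  let χ : ContDiffBump (0 : Plane) := ⟨1, 2, one_pos, one_lt_two⟩
  obtain ⟨M, hM⟩ := (χ.contDiff.continuous_fderiv (n := ∞) (by simp)).bounded_above_of_compact_support
    (χ.hasCompactSupport.fderiv (𝕜 := ℝ))
  have hψ := contDiff_landauGaussian k
  have hψi : Integrable fun x => landauGaussian k x ^ 2 := by
    refine (integrable_exp_neg_mul_norm_sq (half_pos hk)).congr (Eventually.of_forall fun x => ?_)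
    simp only [landauGaussian, ← Real.exp_nat_mul]
    congr 1
    push_cast
    ring
  set G : ℝ := ∫ x, landauGaussian k x ^ 2 with hG
  -- The Gaussian mass of the unit ball bounds the mass of `f` from below for every cutoff scale `R
  -- ≥ 1`.
  set c₀ : ℝ := ∫ x in Metric.closedBall 0 1, landauGaussian k x ^ 2 with hc₀
  have hc₀pos : 0 < c₀ := by
    rw [hc₀, setIntegral_pos_iff_support_of_nonneg_ae (Eventually.of_forall fun x => sq_nonneg _)
      hψi.integrableOn]
    have : Function.support (fun x => landauGaussian k x ^ 2) = univ :=
      Function.support_eq_univ fun x => (pow_pos (Real.exp_pos _) 2).ne'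
    rw [this, univ_inter]
    exact Metric.measure_closedBall_pos _ _ one_pos
  -- The cutoff at scale `R` has partial derivatives at most `M / R`; the factor `2` counts the two
  -- components.
  obtain ⟨R, hR1, hR⟩ : ∃ R : ℝ, 1 ≤ R ∧ 2 * (R⁻¹ * M) ^ 2 * G ≤ ε * c₀ := by
    have ht : Tendsto (fun R : ℝ => 2 * (R⁻¹ * M) ^ 2 * G) atTop (nhds (2 * (0 * M) ^ 2 * G)) :=
      (((tendsto_inv_atTop_zero.mul_const M).pow 2).const_mul 2).mul_const G
    have h0 : 2 * (0 * M) ^ 2 * G < ε * c₀ := by simpa using mul_pos hε hc₀pos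
    obtain ⟨R, h1, h2⟩ := ((ht.eventually (gt_mem_nhds h0)).and (eventually_ge_atTop 1)).exists
    exact ⟨R, h2, h1.le⟩
  have hR0 : 0 < R := one_pos.trans_le hR1
  set χR : Plane → ℝ := fun x => χ (R⁻¹ • x) with hχR
  have hχs : ContDiff ℝ ∞ χR := χ.contDiff.comp (contDiff_const_smul R⁻¹)
  have hχc : HasCompactSupport χR :=
    χ.hasCompactSupport.comp_homeomorph (Homeomorph.smulOfNeZero R⁻¹ (inv_ne_zero hR0.ne'))
  have hχd : ∀ x j, fderiv ℝ χR x (stdVec j) ^ 2 ≤ (R⁻¹ * M) ^ 2 := fun x j => by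
    have h1 : HasFDerivAt (fun x : Plane => R⁻¹ • x) (R⁻¹ • ContinuousLinearMap.id ℝ Plane) x :=
      (R⁻¹ • ContinuousLinearMap.id ℝ Plane).hasFDerivAt
    have h2 : HasFDerivAt χR _ x :=
      ((χ.contDiff.differentiable (n := ∞) (by simp)) (R⁻¹ • x)).hasFDerivAt.comp x h1
    rw [h2.fderiv, sq_le_sq]
    refine le_trans ?_ (le_abs_self _)
    simp only [ContinuousLinearMap.comp_apply, _root_.smul_apply, ContinuousLinearMap.id_apply,
      map_smul, smul_eq_mul, abs_mul, abs_of_pos (inv_pos.2 hR0)]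
    refine mul_le_mul_of_nonneg_left ?_ (inv_pos.2 hR0).le
    refine ((fderiv ℝ χ (R⁻¹ • x)).le_opNorm (stdVec j)).trans ?_
    have : ‖stdVec j‖ = 1 := by simp [stdVec]
    rw [this, mul_one]
    exact hM _
  set f : Plane → ℝ := fun x => χR x * landauGaussian k x with hf
  have hfs : ContDiff ℝ ∞ f := hχs.mul hψ
  have hfc : HasCompactSupport f := hχc.mul_right
  have hfi : Integrable fun x => f x ^ 2 :=
    hfs.continuous.integrable_sq_of_hasCompactSupport hfc
  have hc₀f : c₀ ≤ ∫ x, f x ^ 2 := by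
    refine le_trans (le_of_eq ?_) (setIntegral_le_integral (s := Metric.closedBall 0 1) hfi
      (Eventually.of_forall fun x => sq_nonneg _))
    refine setIntegral_congr_fun Metric.isClosed_closedBall.measurableSet fun x hx => ?_
    have : χR x = 1 := by
      refine χ.one_of_mem_closedBall ?_
      rw [mem_closedBall_zero_iff] at hx ⊢
      rw [norm_smul, norm_inv, Real.norm_of_nonneg hR0.le]
      exact (inv_mul_le_one₀ hR0).2 (hx.trans hR1)
    simp [hf, this]
  refine ⟨f, hfs, hfc, hc₀pos.trans_le hc₀f, ?_⟩
  rw [integral_energy_mul_landauGaussian k hχs hχc hf]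
  have hle : ∫ x, landauGaussian k x ^ 2 * ∑ j, fderiv ℝ χR x (stdVec j) ^ 2 ≤
      2 * (R⁻¹ * M) ^ 2 * G := by
    rw [hG, ← integral_const_mul]
    refine integral_mono_of_nonneg (Eventually.of_forall fun x => by positivity)
      (hψi.const_mul _) (Eventually.of_forall fun x => ?_)
    simp only [Fin.sum_univ_two]
    have := mul_le_mul_of_nonneg_left (add_le_add (hχd x 0) (hχd x 1))
      (sq_nonneg (landauGaussian k x))
    linarith
  have := mul_le_mul_of_nonneg_left hc₀f hε.le
  linarith

/-! ### Gauged trial functions and their energy -/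

lemma HasH10Grad.of_contDiff {Ω : Set Plane} {u : Plane → ℂ} (hu : ContDiff ℝ ∞ u)
    (hc : HasCompactSupport u) (hs : tsupport u ⊆ Ω) :
    HasH10Grad Ω u (fun j x => fderiv ℝ u x (stdVec j)) := by
  have hL : ∀ v, MemLp (fun x => fderiv ℝ u x v) 2 (volume.restrict Ω) := fun v =>
    ((hu.fderiv_apply_const v).continuous.memLp_of_hasCompactSupport
      (hc.fderiv_apply_const v)).restrict Ω
  refine ⟨⟨(hu.continuous.memLp_of_hasCompactSupport hc).restrict Ω, fun j => hL _, ?_⟩, ?_⟩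
  · intro j φ hφ hφc hφs
    rw [setIntegral_eq_integral_of_tsupport_subset hs fun x hx => by simp [hx],
      setIntegral_eq_integral_of_tsupport_subset hφs fun x hx => by simp [hx]]
    have h1 : Integrable (fun x => fderiv ℝ φ x (stdVec j) • u x) :=
      ((hφ.fderiv_apply_const _).continuous.smul hu.continuous).integrable_of_hasCompactSupport
        hc.smul_left
    have h2 : Integrable (fun x => φ x • fderiv ℝ u x (stdVec j)) :=
      (hφ.continuous.smul (hu.fderiv_apply_const _).continuous).integrable_of_hasCompactSupport
        hφc.smul_right
    have h3 : Integrable (fun x => φ x • u x) :=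
      (hφ.continuous.smul hu.continuous).integrable_of_hasCompactSupport hc.smul_left
    rw [integral_smul_fderiv_eq_neg_fderiv_smul_of_integrable h1 h2 h3
      (fun x _ => hφ.differentiable (by simp) x) (fun x _ => hu.differentiable (by simp) x), neg_neg]
  · intro ε _
    exact ⟨u, hu, hc, hs, by simp, fun j => by simp⟩

lemma dirichletEigenvalue_le_of_contDiff {σ : ℝ} {A : Plane → Plane} {Ω : Set Plane}
    {u : Plane → ℂ} (hu : ContDiff ℝ ∞ u) (hc : HasCompactSupport u) (hs : tsupport u ⊆ Ω)
    (h0 : ∫⁻ x in Ω, ‖u x‖ₑ ^ 2 ≠ 0) :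
    dirichletEigenvalue σ A Ω ≤ magneticEnergy σ A Ω u (fun j x => fderiv ℝ u x (stdVec j)) /
      ∫⁻ x in Ω, ‖u x‖ₑ ^ 2 := by
  refine iInf₂_le_of_le u _ (iInf₂_le_of_le (HasH10Grad.of_contDiff hu hc hs) (fun h => h0 ?_)
    le_rfl)
  rw [lintegral_congr_ae (g := fun _ => 0) (h.mono fun x hx => by simp [hx]), lintegral_zero]

/-- The function `v` multiplied by the gauge phase `exp(iσθ)`. -/
def gaugedFunction (σ : ℝ) (θ v : Plane → ℝ) (x : Plane) : ℂ :=
  Complex.exp (Complex.I * ((σ * θ x : ℝ) : ℂ)) * (v x : ℂ)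

section Trial

variable {σ : ℝ} {θ v : Plane → ℝ} {s : Set Plane}

lemma tsupport_gaugedFunction_subset : tsupport (gaugedFunction σ θ v) ⊆ tsupport v :=
  closure_mono fun x hx => by
    contrapose! hx
    simp only [Function.mem_support, not_not] at hx ⊢
    simp [gaugedFunction, hx]

/-- The phase `θ` is smooth only on `s`, but off the support of `v` the product vanishes locally. -/
lemma contDiff_gaugedFunction (hs : IsOpen s) (hθ : ContDiffOn ℝ ∞ θ s) (hv : ContDiff ℝ ∞ v)
    (hvs : tsupport v ⊆ s) : ContDiff ℝ ∞ (gaugedFunction σ θ v) := by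
  refine contDiff_iff_contDiffAt.2 fun x => ?_
  by_cases hx : x ∈ tsupport v
  · have h1 : ContDiffAt ℝ ∞ θ x := hθ.contDiffAt (hs.mem_nhds (hvs hx))
    have h2 : ContDiffAt ℝ ∞ (fun x => ((σ * θ x : ℝ) : ℂ)) x :=
      Complex.ofRealCLM.contDiff.contDiffAt.comp x (contDiffAt_const.mul h1)
    exact (contDiffAt_const.mul h2).cexp.mul (Complex.ofRealCLM.contDiff.contDiffAt.comp x hv.contDiffAt)
  · have : gaugedFunction σ θ v =ᶠ[nhds x] fun _ => 0 :=
      notMem_tsupport_iff_eventuallyEq.1 fun h => hx (tsupport_gaugedFunction_subset h)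
    exact contDiffAt_const.congr_of_eventuallyEq this

lemma enorm_gaugedFunction_sq (x : Plane) :
    ‖gaugedFunction σ θ v x‖ₑ ^ 2 = ENNReal.ofReal (v x ^ 2) := by
  rw [gaugedFunction, enorm_mul, ← ofReal_norm, mul_comm Complex.I, Complex.norm_exp_ofReal_mul_I,
    ENNReal.ofReal_one, one_mul, enorm_sq_eq_ofReal]
  simp

/-- The gauge transformation of the magnetic energy density. -/
lemma enorm_magneticGradient_gaugedFunction_sq {x : Plane} (hθ : DifferentiableAt ℝ θ x)
    (hv : DifferentiableAt ℝ v x) (w : Plane) (α : ℝ) :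
    ‖fderiv ℝ (gaugedFunction σ θ v) x w -
        Complex.I * (σ : ℂ) * (α : ℂ) * gaugedFunction σ θ v x‖ₑ ^ 2 =
      ENNReal.ofReal (fderiv ℝ v x w ^ 2 + (σ * (α - fderiv ℝ θ x w) * v x) ^ 2) := by
  have h1 : HasFDerivAt (fun x => ((σ * θ x : ℝ) : ℂ))
      (Complex.ofRealCLM.comp (σ • fderiv ℝ θ x)) x :=
    Complex.ofRealCLM.hasFDerivAt.comp x (hθ.hasFDerivAt.const_mul σ)
  have h2 : HasFDerivAt (fun x => ((v x : ℝ) : ℂ)) (Complex.ofRealCLM.comp (fderiv ℝ v x)) x :=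
    Complex.ofRealCLM.hasFDerivAt.comp x hv.hasFDerivAt
  have h3 : HasFDerivAt (gaugedFunction σ θ v) _ x := ((h1.const_mul Complex.I).cexp).mul h2
  rw [h3.fderiv]
  have h4 : ∀ z : ℂ, ‖Complex.exp (Complex.I * ((σ * θ x : ℝ) : ℂ)) * z‖ₑ ^ 2 = ‖z‖ₑ ^ 2 := by
    intro z
    rw [enorm_mul, ← ofReal_norm, mul_comm Complex.I, Complex.norm_exp_ofReal_mul_I,
      ENNReal.ofReal_one, one_mul]
  have h5 : (fderiv ℝ v x w ^ 2 + (σ * (α - fderiv ℝ θ x w) * v x) ^ 2) =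
      ((fderiv ℝ v x w : ℂ) - Complex.I * ((σ * (α - fderiv ℝ θ x w) * v x : ℝ) : ℂ)).re ^ 2 +
      ((fderiv ℝ v x w : ℂ) - Complex.I * ((σ * (α - fderiv ℝ θ x w) * v x : ℝ) : ℂ)).im ^ 2 := by
    simp
  rw [h5, ← enorm_sq_eq_ofReal]
  refine Eq.trans ?_ (h4 _)
  congr 2
  simp [gaugedFunction]
  ring

/-- Energy of a gauged test function, compared with the energy of `v` in the potential `a`. -/
lemma magneticEnergy_gaugedFunction_le {Ω : Set Plane} {A : Plane → Plane} (hs : IsOpen s)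
    (hA : ∀ j, AEStronglyMeasurable (fun x => A x j) (volume.restrict s))
    (hθ : ContDiffOn ℝ ∞ θ s) (hv : ContDiff ℝ ∞ v) (hvc : HasCompactSupport v)
    (hvs : tsupport v ⊆ s) {M : ℝ} (hM : ∀ x, |v x| ≤ M) {a : Fin 2 → Plane → ℝ}
    (ha : ∀ j, Continuous (a j)) {η : ℝ} (hη : 0 < η) :
    magneticEnergy σ A Ω (gaugedFunction σ θ v)
        (fun j x => fderiv ℝ (gaugedFunction σ θ v) x (stdVec j)) ≤
      ENNReal.ofReal ((1 + η) *
        ∫ x, ∑ j, (fderiv ℝ v x (stdVec j) ^ 2 + (σ * a j x * v x) ^ 2)) +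
      ENNReal.ofReal ((1 + η⁻¹) * (σ * M) ^ 2) *
        ∑ j, ∫⁻ x in s, ‖A x j - fderiv ℝ θ x (stdVec j) - a j x‖ₑ ^ 2 := by
  set X : Plane → ℝ := fun x => ∑ j, (fderiv ℝ v x (stdVec j) ^ 2 + (σ * a j x * v x) ^ 2) with hX
  set e : Fin 2 → Plane → ℝ := fun j x => A x j - fderiv ℝ θ x (stdVec j) - a j x with he
  set D : Plane → ℝ≥0∞ := fun x => ∑ j, ‖fderiv ℝ (gaugedFunction σ θ v) x (stdVec j) -
    Complex.I * (σ : ℂ) * ((A x j : ℝ) : ℂ) * gaugedFunction σ θ v x‖ₑ ^ 2 with hD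
  have hM0 : 0 ≤ M := (abs_nonneg _).trans (hM 0)
  have hη' : 0 < η⁻¹ := inv_pos.2 hη
  have hX0 : ∀ x, 0 ≤ X x := fun x => Finset.sum_nonneg fun j _ => by positivity
  have hXi : Integrable X := integrable_finsetSum _ fun j _ =>
    ((hv.fderiv_apply_const _).continuous.integrable_sq_of_hasCompactSupport
      (hvc.fderiv_apply_const _)).add
    (((continuous_const.mul (ha j)).mul hv.continuous).integrable_sq_of_hasCompactSupport
      hvc.mul_left)
  have hDs : ∀ x ∉ s, D x = 0 := by
    intro x hx
    have h1 : x ∉ tsupport (gaugedFunction σ θ v) := fun h =>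
      hx (hvs (tsupport_gaugedFunction_subset h))
    have h2 : fderiv ℝ (gaugedFunction σ θ v) x = 0 :=
      image_eq_zero_of_notMem_tsupport fun h => h1 (tsupport_fderiv_subset ℝ h)
    simp [hD, h2, image_eq_zero_of_notMem_tsupport h1]
  have hDle : ∀ x ∈ s, D x ≤ ENNReal.ofReal ((1 + η) * X x) +
      ENNReal.ofReal ((1 + η⁻¹) * (σ * M) ^ 2) * ∑ j, ‖e j x‖ₑ ^ 2 := by
    intro x hx
    have hθd : DifferentiableAt ℝ θ x :=
      (hθ.contDiffAt (hs.mem_nhds hx)).differentiableAt (by simp)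
    simp only [hD, enorm_magneticGradient_gaugedFunction_sq hθd (hv.differentiable (by simp) x)]
    have h1 : ∀ j, ‖e j x‖ₑ ^ 2 = ENNReal.ofReal (e j x ^ 2) := fun j => by
      rw [← ofReal_norm, ← ENNReal.ofReal_pow (norm_nonneg _), Real.norm_eq_abs, sq_abs]
    simp only [h1]
    rw [← ENNReal.ofReal_sum_of_nonneg fun j _ => by positivity,
      ← ENNReal.ofReal_sum_of_nonneg fun j _ => by positivity, ← ENNReal.ofReal_mul (by positivity),
      ← ENNReal.ofReal_add (mul_nonneg (by positivity) (hX0 x)) (by positivity)]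
    refine ENNReal.ofReal_le_ofReal ?_
    rw [hX, Finset.mul_sum, Finset.mul_sum, ← Finset.sum_add_distrib]
    refine Finset.sum_le_sum fun j _ => ?_
    have h2 : A x j - fderiv ℝ θ x (stdVec j) = a j x + e j x := by simp only [he]; ring
    rw [h2]
    have h3 : (σ * e j x * v x) ^ 2 ≤ (σ * M) ^ 2 * e j x ^ 2 := by
      have : v x ^ 2 ≤ M ^ 2 := sq_le_sq' (by linarith [neg_abs_le (v x), hM x])
        ((le_abs_self _).trans (hM x))
      calc (σ * e j x * v x) ^ 2 = (σ * e j x) ^ 2 * v x ^ 2 := by ring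
        _ ≤ (σ * e j x) ^ 2 * M ^ 2 := by gcongr
        _ = _ := by ring
    set p := σ * a j x * v x
    set q := σ * e j x * v x
    have h4 : σ * (a j x + e j x) * v x = p + q := by simp only [p, q]; ring
    -- Young's inequality with parameter `η` separates the model potential `a` from the error `e`.
    have h5 : (p + q) ^ 2 ≤ (1 + η) * p ^ 2 + (1 + η⁻¹) * q ^ 2 := by
      have h6 : 0 ≤ η⁻¹ * (η * p - q) ^ 2 := by positivity
      have h7 : η⁻¹ * (η * p - q) ^ 2 = η * p ^ 2 - 2 * p * q + η⁻¹ * q ^ 2 := by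
        field_simp
        ring
      nlinarith
    rw [h4]
    have h8 := mul_le_mul_of_nonneg_left h3 (by positivity : (0 : ℝ) ≤ 1 + η⁻¹)
    nlinarith [mul_nonneg hη.le (sq_nonneg (fderiv ℝ v x (stdVec j)))]
  have hem : ∀ j, AEStronglyMeasurable (e j) (volume.restrict s) := fun j =>
    ((hA j).sub (measurable_fderiv_apply_const ℝ θ _).aestronglyMeasurable).sub
      (ha j).aestronglyMeasurable
  calc magneticEnergy σ A Ω _ _ = ∫⁻ x in Ω, D x := rfl
    _ ≤ ∫⁻ x, D x := setLIntegral_le_lintegral _ _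
    _ = ∫⁻ x in s, D x := by
        rw [← lintegral_indicator hs.measurableSet]
        congr 1 with x
        by_cases hx : x ∈ s
        · simp [hx]
        · simp [hx, hDs x hx]
    _ ≤ ∫⁻ x in s, (ENNReal.ofReal ((1 + η) * X x) +
          ENNReal.ofReal ((1 + η⁻¹) * (σ * M) ^ 2) * ∑ j, ‖e j x‖ₑ ^ 2) :=
        setLIntegral_mono' hs.measurableSet hDle
    _ = (∫⁻ x in s, ENNReal.ofReal ((1 + η) * X x)) + ENNReal.ofReal ((1 + η⁻¹) * (σ * M) ^ 2) *
          ∑ j, ∫⁻ x in s, ‖e j x‖ₑ ^ 2 := by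
        rw [lintegral_add_left' ((hXi.const_mul _).aestronglyMeasurable.aemeasurable.ennreal_ofReal
          |>.restrict), lintegral_const_mul' _ _ ENNReal.ofReal_ne_top,
          lintegral_finsetSum' _ fun j _ => (hem j).enorm.pow_const 2]
    _ ≤ _ := by
        gcongr
        refine (setLIntegral_le_lintegral _ _).trans (le_of_eq ?_)
        rw [← integral_const_mul, ofReal_integral_eq_lintegral_ofReal (hXi.const_mul _)
          (Eventually.of_forall fun x => mul_nonneg (by positivity) (hX0 x))]

end Trial

/-! ### Centred potentials and Lebesgue points -/

/-- The potential generated by `b` with respect to the centre `c`. -/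
def centeredPotential (c : Plane) (b : Plane → ℝ) (k : Fin 2) (x : Plane) : ℝ :=
  radialPotential (fun y => b (c + y)) k (x - c)

lemma MemLp.comp_const_add {b : Plane → ℝ} (hb : MemLp b 2 volume) (c : Plane) :
    MemLp (fun y => b (c + y)) 2 volume :=
  hb.comp_measurePreserving (measurePreserving_add_left volume c)

lemma hasWeakCurl_centeredPotential {b : Plane → ℝ} (hb : MemLp b 2 volume) (c : Plane)
    (Ω : Set Plane) : HasWeakCurl Ω (centeredPotential c b) b := by
  intro φ hφ hc hs
  have hd : ∀ x ∉ Ω, ∀ v, fderiv ℝ φ x v = 0 := fun x hx v => by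
    rw [image_eq_zero_of_notMem_tsupport fun h => hx (hs (tsupport_fderiv_subset ℝ h))]; rfl
  rw [setIntegral_eq_integral_of_forall_compl_eq_zero fun x hx => by simp [hd x hx],
    setIntegral_eq_integral_of_tsupport_subset hs fun x hx => by simp [hx],
    ← integral_add_left_eq_self _ c, ← integral_add_left_eq_self (fun x => φ x * b x) c]
  have h := integral_radialPotential (φ := fun y => φ (c + y)) (MemLp.comp_const_add hb c)
    (hφ.comp (contDiff_const.add contDiff_id)) (hc.comp_homeomorph (Homeomorph.addLeft c))
  simp only [fderiv_comp_add_left] at h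
  simpa [centeredPotential] using h

lemma setLIntegral_closedBall_comp_sub (c : Plane) (l : ℝ) (h : Plane → ℝ≥0∞) :
    ∫⁻ x in Metric.closedBall c l, h (x - c) = ∫⁻ x in Metric.closedBall 0 l, h x := by
  rw [← lintegral_indicator Metric.isClosed_closedBall.measurableSet,
    ← lintegral_indicator Metric.isClosed_closedBall.measurableSet,
    ← lintegral_sub_right_eq_self ((Metric.closedBall 0 l).indicator h) c]
  congr 1 with x
  simp [indicator, Metric.mem_closedBall, dist_eq_norm]

lemma memLp_centeredPotential {b : Plane → ℝ} (hb : MemLp b 2 volume) (c : Plane) {S : Set Plane}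
    (hS : Bornology.IsBounded S) (k : Fin 2) :
    MemLp (centeredPotential c b k) 2 (volume.restrict S) := by
  obtain ⟨l, hl, hSl⟩ := hS.subset_closedBall_lt 0 c
  have h1 := (memLp_indicator_iff_restrict Metric.isClosed_closedBall.measurableSet).2
    (memLp_radialPotential (MemLp.comp_const_add hb c)
      (Metric.isBounded_closedBall (x := (0 : Plane)) (r := l)) k)
  have h2 := (h1.comp_measurePreserving (measurePreserving_sub_right volume c)).restrict
    (Metric.closedBall c l)
  refine MemLp.mono_measure (Measure.restrict_mono_set _ hSl) (h2.ae_eq ?_)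
  filter_upwards [ae_restrict_mem Metric.isClosed_closedBall.measurableSet] with x hx
  have : x - c ∈ Metric.closedBall (0 : Plane) l := by
    simpa [Metric.mem_closedBall, dist_eq_norm] using hx
  simp [Function.comp, indicator_of_mem this, centeredPotential]

/-- Near `c`, the centred potential is `L²`-close to that of a constant field. -/
lemma lintegral_centeredPotential_sub_sq_le {b : Plane → ℝ} (hb : MemLp b 2 volume) (c : Plane)
    (k : ℝ) {l : ℝ} (hl : 0 ≤ l) (j : Fin 2) :
    ∫⁻ x in Metric.closedBall c l,
        ‖centeredPotential c b j x - k * canonicalPotential (x - c) j‖ₑ ^ 2 ≤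
      ENNReal.ofReal (l ^ 2) * ∫⁻ x in Metric.closedBall c l, ‖b x - k‖ₑ ^ 2 := by
  have hbc := MemLp.comp_const_add hb c
  have h1 := setLIntegral_closedBall_comp_sub c l fun y =>
    ‖radialPotential (fun y => b (c + y)) j y - k * canonicalPotential y j‖ₑ ^ 2
  have h2 := setLIntegral_closedBall_comp_sub c l fun y => ‖b (c + y) - k‖ₑ ^ 2
  simp only [add_sub_cancel] at h2
  have h3 := lintegral_radialPotential_sq_le (b := fun y => b (c + y) - k)
    (hbc.aestronglyMeasurable.sub aestronglyMeasurable_const) hl j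
  calc _ = _ := h1
    _ = ∫⁻ x in Metric.closedBall 0 l, ‖radialPotential (fun y => b (c + y) - k) j x‖ₑ ^ 2 := by
        refine lintegral_congr_ae ?_
        filter_upwards [ae_radialPotential_sub_const hbc k l] with x hx
        rw [hx j]
    _ ≤ _ := by rw [h2]; exact h3

/-- Almost every point is a Lebesgue point in the sense of `L²`. -/
lemma ae_eventually_lintegral_sub_sq_le {b : Plane → ℝ} (hb : MemLp b 2 volume) :
    ∀ᵐ c, ∀ δ : ℝ, 0 < δ → ∀ᶠ l in nhdsWithin (0 : ℝ) (Ioi 0),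
      ∫⁻ x in Metric.closedBall c l, ‖b x - b c‖ₑ ^ 2 ≤ ENNReal.ofReal (δ * l ^ 2) := by
  have hb2 : Integrable (fun x => b x ^ 2) := hb.integrable_sq
  -- Lebesgue differentiation is applied to `b` and to `b²`; expanding `(b - b c)²`, its averages
  -- tend to `b(c)² - 2 b(c)² + b(c)² = 0`.
  filter_upwards [IsUnifLocDoublingMeasure.ae_tendsto_average volume
    (hb.locallyIntegrable one_le_two) 1,
    IsUnifLocDoublingMeasure.ae_tendsto_average volume hb2.locallyIntegrable 1] with c h1 h2 δ hδ
  have hmem : ∀ᶠ l in nhdsWithin (0 : ℝ) (Ioi 0), c ∈ Metric.closedBall c (1 * l) := by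
    filter_upwards [self_mem_nhdsWithin] with l hl
    exact Metric.mem_closedBall_self (by simpa using (le_of_lt hl))
  have t1 := h1 (fun _ : ℝ => c) (fun l => l) tendsto_id hmem
  have t2 := h2 (fun _ : ℝ => c) (fun l => l) tendsto_id hmem
  -- The area of the unit disc converts the bound on averages into `δ l²` for the integral.
  set κ : ℝ := volume.real (Metric.ball (0 : Plane) 1) with hκ
  have hκ0 : 0 < κ := ENNReal.toReal_pos (Metric.measure_ball_pos _ _ one_pos).ne'
    Metric.isBounded_ball.measure_lt_top.ne
  have t3 := (t2.sub (t1.const_mul (2 * b c))).add_const (b c ^ 2)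
  have h0 : b c ^ 2 - 2 * b c * b c + b c ^ 2 = 0 := by ring
  rw [h0] at t3
  filter_upwards [t3.eventually (gt_mem_nhds (div_pos hδ hκ0)), self_mem_nhdsWithin] with l hl hl0
  have hl0' : (0 : ℝ) < l := hl0
  set S := Metric.closedBall c l with hS
  have hvol : volume.real S = l ^ 2 * κ := by
    rw [hκ, Measure.real, hS, Measure.addHaar_closedBall _ _ hl0'.le, ENNReal.toReal_mul,
      ENNReal.toReal_ofReal (by positivity)]
    simp [Measure.real]
  have hfin : volume S ≠ ⊤ := Metric.isBounded_closedBall.measure_lt_top.ne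
  have i1 : IntegrableOn b S := (hb.locallyIntegrable one_le_two).integrableOn_isCompact
    (isCompact_closedBall c l)
  have i2 : IntegrableOn (fun x => b x ^ 2) S := hb2.integrableOn
  have i3 : IntegrableOn (fun _ : Plane => b c ^ 2) S := integrableOn_const hfin
  have i4 : IntegrableOn (fun x => 2 * b c * b x) S := i1.const_mul _
  have i5 : IntegrableOn (fun x => b x ^ 2 - 2 * b c * b x) S := i2.sub i4
  have hexp : ∀ x, (b x - b c) ^ 2 = b x ^ 2 - 2 * b c * b x + b c ^ 2 := fun x => by ring
  have i6 : IntegrableOn (fun x => (b x - b c) ^ 2) S := by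
    simp only [hexp]
    exact i5.add i3
  have hint : ∫ x in S, (b x - b c) ^ 2 ≤ δ * l ^ 2 := by
    have hpos : 0 < l ^ 2 * κ := by positivity
    simp only [hexp]
    rw [integral_add i5 i3, integral_sub i2 i4, integral_const_mul, setIntegral_const]
    rw [setAverage_eq, setAverage_eq, hvol] at hl
    rw [hvol]
    simp only [smul_eq_mul] at hl ⊢
    have h3 := mul_lt_mul_of_pos_left hl hpos
    have h4 : l ^ 2 * κ * (δ / κ) = δ * l ^ 2 := by field_simp
    have h5 : ∀ p q : ℝ, l ^ 2 * κ * ((l ^ 2 * κ)⁻¹ * p - 2 * b c * ((l ^ 2 * κ)⁻¹ * q) + b c ^ 2) =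
        p - 2 * b c * q + l ^ 2 * κ * b c ^ 2 := fun p q => by
      field_simp
    rw [h4, h5] at h3
    exact h3.le
  have : ∀ x, ‖b x - b c‖ₑ ^ 2 = ENNReal.ofReal ((b x - b c) ^ 2) := fun x => by
    rw [← ofReal_norm, ← ENNReal.ofReal_pow (norm_nonneg _), Real.norm_eq_abs, sq_abs]
  simp only [this]
  rw [← ofReal_integral_eq_lintegral_ofReal i6 (Eventually.of_forall fun x => sq_nonneg _)]
  exact ENNReal.ofReal_le_ofReal hint

/-! ### Localized trial functions and the upper bound -/

lemma lintegral_enorm_gaugedFunction_sq {Ω : Set Plane} {σ : ℝ} {θ v : Plane → ℝ}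
    (hv : Continuous v) (hvc : HasCompactSupport v) (hvs : tsupport v ⊆ Ω) :
    ∫⁻ x in Ω, ‖gaugedFunction σ θ v x‖ₑ ^ 2 = ENNReal.ofReal (∫ x, v x ^ 2) := by
  simp only [enorm_gaugedFunction_sq]
  rw [← setIntegral_eq_integral_of_tsupport_subset hvs fun x hx => by simp [hx],
    ofReal_integral_eq_lintegral_ofReal (hv.integrable_sq_of_hasCompactSupport hvc).integrableOn
    (Eventually.of_forall fun x => sq_nonneg _)]

/-- A bump function has finite energy for every `A ∈ L²`, because the bump is bounded; no gauge is
needed. -/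
lemma dirichletEigenvalue_lt_top {Ω : Set Plane} (hΩ : IsOpen Ω) (hne : Ω.Nonempty)
    {A : Plane → Plane} (hA : ∀ k, MemLp (fun x => A x k) 2 (volume.restrict Ω)) (σ : ℝ) :
    dirichletEigenvalue σ A Ω < ⊤ := by
  obtain ⟨c, hc⟩ := hne
  obtain ⟨R, hR, hball⟩ := Metric.isOpen_iff.1 hΩ c hc
  let χ : ContDiffBump c := ⟨R / 4, R / 2, by linarith, by linarith⟩
  have hχs : tsupport χ ⊆ Ω := by
    rw [χ.tsupport_eq]
    exact (Metric.closedBall_subset_ball (by change R / 2 < R; linarith)).trans hball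
  have hχ : ContDiff ℝ ∞ χ := χ.contDiff
  have hpos : 0 < ∫ x, χ x ^ 2 := by
    refine Continuous.integral_pos_of_hasCompactSupport_nonneg_nonzero (f := fun x => χ x ^ 2)
      (x := c) (hχ.continuous.pow 2) ?_ (fun x => sq_nonneg _) ?_
    · simp only [sq]
      exact χ.hasCompactSupport.mul_right
    · simp [χ.one_of_mem_closedBall (Metric.mem_closedBall_self χ.rIn_pos.le)]
  have hθ : ContDiffOn ℝ ∞ (fun _ : Plane => (0 : ℝ)) Ω := contDiffOn_const
  have hn := lintegral_enorm_gaugedFunction_sq (σ := σ) (θ := fun _ => 0) hχ.continuous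
    χ.hasCompactSupport hχs
  have hle := magneticEnergy_gaugedFunction_le (σ := σ) (Ω := Ω) (M := 1) (η := 1)
    (a := fun _ _ => 0) hΩ (fun j => (hA j).aestronglyMeasurable) hθ hχ χ.hasCompactSupport hχs
    (fun x => by rw [abs_of_nonneg χ.nonneg]; exact χ.le_one) (fun _ => continuous_const) one_pos
  have hE : magneticEnergy σ A Ω (gaugedFunction σ (fun _ => 0) χ)
      (fun j x => fderiv ℝ (gaugedFunction σ (fun _ => 0) χ) x (stdVec j)) < ⊤ := by
    refine hle.trans_lt (ENNReal.add_lt_top.2 ⟨ENNReal.ofReal_lt_top,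
      ENNReal.mul_lt_top ENNReal.ofReal_lt_top (ENNReal.sum_lt_top.2 fun j _ => ?_)⟩)
    simp only [fderiv_fun_const, Pi.zero_apply, _root_.zero_apply, sub_zero]
    rw [← eLpNorm_two_sq]
    exact ENNReal.pow_lt_top (hA j).eLpNorm_lt_top
  have h0 : ∫⁻ x in Ω, ‖gaugedFunction σ (fun _ => 0) χ x‖ₑ ^ 2 ≠ 0 := by
    rw [hn]
    simpa using hpos
  refine (dirichletEigenvalue_le_of_contDiff (contDiff_gaugedFunction hΩ hθ hχ hχs)
    (χ.hasCompactSupport.of_isClosed_subset isClosed_closure tsupport_gaugedFunction_subset)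
    (tsupport_gaugedFunction_subset.trans hχs) h0).trans_lt ?_
  exact ENNReal.div_lt_top hE.ne h0

/-- Rescaling a test function around the point `c`. -/
lemma rescaled_testFunction {f : Plane → ℝ} (hf : ContDiff ℝ ∞ f) {L : ℝ}
    (hL : tsupport f ⊆ Metric.closedBall 0 L) (c : Plane) {s : ℝ} (hs : 0 < s) (k : ℝ)
    {v : Plane → ℝ} (hv : v = fun x => f (s • (x - c))) :
    ContDiff ℝ ∞ v ∧ tsupport v ⊆ Metric.closedBall c (L / s) ∧
      ∫ x, v x ^ 2 = (s ^ 2)⁻¹ * ∫ x, f x ^ 2 ∧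
      ∫ x, ∑ j, (fderiv ℝ v x (stdVec j) ^ 2 +
          (s ^ 2 * (k * canonicalPotential (x - c) j) * v x) ^ 2) =
        ∫ x, ∑ j, (fderiv ℝ f x (stdVec j) ^ 2 + (k * canonicalPotential x j * f x) ^ 2) := by
  have hscale : ∀ g : Plane → ℝ, ∫ x, g (s • (x - c)) = (s ^ 2)⁻¹ * ∫ x, g x := fun g => by
    rw [integral_sub_right_eq_self (fun x => g (s • x)) c,
      Measure.integral_comp_smul_of_nonneg (volume : Measure Plane) g s (hR := hs.le)]
    simp
  refine ⟨?_, ?_, ?_, ?_⟩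
  · rw [hv]
    exact hf.comp ((contDiff_const_smul s).comp (contDiff_id.sub contDiff_const))
  · refine closure_minimal (fun x hx => ?_) Metric.isClosed_closedBall
    have h1 : s • (x - c) ∈ tsupport f := subset_tsupport f (by
      rw [hv] at hx
      exact hx)
    have h2 := mem_closedBall_zero_iff.1 (hL h1)
    rw [norm_smul, Real.norm_of_nonneg hs.le] at h2
    rw [Metric.mem_closedBall, dist_eq_norm, le_div_iff₀ hs]
    linarith
  · rw [hv]
    exact hscale fun y => f y ^ 2
  · have h1 : ∀ x w, fderiv ℝ v x w = s * fderiv ℝ f (s • (x - c)) w := fun x w => by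
      have h0 : HasFDerivAt (fun x : Plane => x - c) (ContinuousLinearMap.id ℝ Plane) x :=
        (hasFDerivAt_id x).sub_const c
      have h2 : HasFDerivAt (fun x : Plane => s • (x - c)) (s • ContinuousLinearMap.id ℝ Plane) x :=
        h0.const_smul s
      have h3 : HasFDerivAt v ((fderiv ℝ f (s • (x - c))).comp
          (s • ContinuousLinearMap.id ℝ Plane)) x := by
        rw [hv]
        exact (hf.differentiable (by simp) (s • (x - c))).hasFDerivAt.comp x h2
      rw [h3.fderiv]
      simp
    -- Dilation by `s` multiplies the field by `s²` and the energy density by `s²`, so in two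
    -- dimensions the energy integral is invariant.
    have h4 : ∀ x, ∑ j, (fderiv ℝ v x (stdVec j) ^ 2 +
          (s ^ 2 * (k * canonicalPotential (x - c) j) * v x) ^ 2) =
        s ^ 2 * ∑ j, (fderiv ℝ f (s • (x - c)) (stdVec j) ^ 2 +
          (k * canonicalPotential (s • (x - c)) j * f (s • (x - c))) ^ 2) := fun x => by
      rw [Finset.mul_sum]
      refine Finset.sum_congr rfl fun j _ => ?_
      rw [h1, canonicalPotential_smul, hv]
      simp only [PiLp.smul_apply, smul_eq_mul]
      ring
    simp only [h4]
    rw [integral_const_mul, hscale fun y => ∑ j, (fderiv ℝ f y (stdVec j) ^ 2 +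
      (k * canonicalPotential y j * f y) ^ 2), mul_inv_cancel_left₀ (by positivity)]

lemma HasWeakCurl.sub {Ω : Set Plane} {A A' : Fin 2 → Plane → ℝ} {b b' : Plane → ℝ}
    (hA : ∀ k, MemLp (A k) 2 (volume.restrict Ω)) (hA' : ∀ k, MemLp (A' k) 2 (volume.restrict Ω))
    (h : HasWeakCurl Ω A b) (h' : HasWeakCurl Ω A' b') (hbb : ∀ x ∈ Ω, b x = b' x)
    (hΩ : MeasurableSet Ω) : HasWeakCurl Ω (fun k x => A k x - A' k x) 0 := by
  intro φ hφ hc hs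
  have hi : ∀ {V : Fin 2 → Plane → ℝ}, (∀ k, MemLp (V k) 2 (volume.restrict Ω)) →
      Integrable (fun x => fderiv ℝ φ x (stdVec 0) * V 1 x - fderiv ℝ φ x (stdVec 1) * V 0 x)
        (volume.restrict Ω) := fun hV => by
    have hD : ∀ v, MemLp (fun x => fderiv ℝ φ x v) 2 (volume.restrict Ω) := fun v =>
      ((hφ.fderiv_apply_const v).continuous.memLp_of_hasCompactSupport
        (hc.fderiv_apply_const v)).restrict Ω
    exact ((hD _).integrable_mul (hV 1)).sub ((hD _).integrable_mul (hV 0))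
  have h1 := h φ hφ hc hs
  have h2 := h' φ hφ hc hs
  have h3 : ∫ x in Ω, φ x * b x = ∫ x in Ω, φ x * b' x :=
    setIntegral_congr_fun hΩ fun x hx => by simp only [hbb x hx]
  have h4 : ∀ x, fderiv ℝ φ x (stdVec 0) * (A 1 x - A' 1 x) -
      fderiv ℝ φ x (stdVec 1) * (A 0 x - A' 0 x) =
      (fderiv ℝ φ x (stdVec 0) * A 1 x - fderiv ℝ φ x (stdVec 1) * A 0 x) -
      (fderiv ℝ φ x (stdVec 0) * A' 1 x - fderiv ℝ φ x (stdVec 1) * A' 0 x) := fun x => by ring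
  simp only [h4]
  rw [integral_sub (hi hA) (hi hA'), h1, h2, h3]
  simp

section UpperBound

variable {Ω : Set Plane} {A : Plane → Plane} {B : Plane → ℝ}

/-- Near an `L²`-Lebesgue point of the field, a gauge makes the potential `L²`-close to the
potential of a constant field. -/
lemma exists_gauge (hΩ : IsOpen Ω) (hΩb : Bornology.IsBounded Ω)
    (hA : ∀ k, MemLp (fun x => A x k) 2 (volume.restrict Ω))
    (hB : MemLp B 2 (volume.restrict Ω)) (hcurl : HasWeakCurl Ω (fun k x => A x k) B)
    {c : Plane} {k d l : ℝ} (hd : 0 < d) (hl : 0 < l) (hball : Metric.ball c (2 * l) ⊆ Ω)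
    (hleb : ∫⁻ x in Metric.closedBall c l, ‖Ω.indicator B x - k‖ₑ ^ 2 ≤
      ENNReal.ofReal (d ^ 2 * l ^ 2)) :
    ∃ θ : Plane → ℝ, ContDiffOn ℝ ∞ θ (Metric.ball c l) ∧ ∀ j,
      ∫⁻ x in Metric.ball c l, ‖A x j - fderiv ℝ θ x (stdVec j) -
        k * canonicalPotential (x - c) j‖ₑ ^ 2 ≤ ENNReal.ofReal (4 * d ^ 2 * l ^ 4) := by
  have hb : MemLp (Ω.indicator B) 2 volume := (memLp_indicator_iff_restrict hΩ.measurableSet).2 hB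
  set P := centeredPotential c (Ω.indicator B) with hP
  have hPL : ∀ j, MemLp (P j) 2 (volume.restrict Ω) := fun j => memLp_centeredPotential hb c hΩb j
  have hq : 0 < d * l ^ 2 := by positivity
  -- On `Ω` both `A` and the centred potential `P` have weak curl `B`. The gradient tolerance `d l²`
  -- matches the distance from `P` to the constant-field potential, which gives `(2 d l²)²` in the
  -- end.
  obtain ⟨θ, hθ, hθle⟩ := exists_gradient_approx hΩ (W := fun k x => A x k - P k x)
    (fun j => (hA j).sub (hPL j))
    (HasWeakCurl.sub hA hPL hcurl (hasWeakCurl_centeredPotential hb c Ω)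
      (fun x hx => by simp [hx]) hΩ.measurableSet)
    (by linarith : l < 2 * l) hball (ENNReal.ofReal_pos.2 hq).ne'
  have hsub : Metric.ball c l ⊆ Ω := (Metric.ball_subset_ball (by linarith)).trans hball
  refine ⟨θ, hθ, fun j => ?_⟩
  set w : Plane → ℝ := fun x => A x j - P j x - fderiv ℝ θ x (stdVec j) with hw
  set a : Plane → ℝ := fun x => P j x - k * canonicalPotential (x - c) j with ha
  have hwm : AEStronglyMeasurable w (volume.restrict (Metric.ball c l)) :=
    (((hA j).sub (hPL j)).mono_measure (Measure.restrict_mono_set _ hsub)).aestronglyMeasurable.sub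
      (measurable_fderiv_apply_const ℝ θ _).aestronglyMeasurable
  have ham : AEStronglyMeasurable a (volume.restrict (Metric.ball c l)) :=
    ((hPL j).mono_measure (Measure.restrict_mono_set _ hsub)).aestronglyMeasurable.sub
      (continuous_const.mul ((continuous_canonicalPotential_apply j).comp
        (continuous_id.sub continuous_const))).aestronglyMeasurable
  have hale : eLpNorm a 2 (volume.restrict (Metric.ball c l)) ≤ ENNReal.ofReal (d * l ^ 2) := by
    rw [← ENNReal.pow_le_pow_left_iff two_ne_zero, eLpNorm_two_sq]
    calc ∫⁻ x in Metric.ball c l, ‖a x‖ₑ ^ 2 ≤ ∫⁻ x in Metric.closedBall c l, ‖a x‖ₑ ^ 2 :=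
          lintegral_mono_set Metric.ball_subset_closedBall
      _ ≤ ENNReal.ofReal (l ^ 2) * ENNReal.ofReal (d ^ 2 * l ^ 2) :=
          (lintegral_centeredPotential_sub_sq_le hb c k hl.le j).trans (mul_le_mul' le_rfl hleb)
      _ = ENNReal.ofReal (d * l ^ 2) ^ 2 := by
          rw [← ENNReal.ofReal_mul (by positivity), ← ENNReal.ofReal_pow hq.le]
          congr 1
          ring
  have hsum : (fun x => A x j - fderiv ℝ θ x (stdVec j) - k * canonicalPotential (x - c) j) =
      w + a := by
    ext x
    simp only [hw, ha, Pi.add_apply]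
    ring
  rw [← eLpNorm_two_sq, hsum]
  calc eLpNorm (w + a) 2 (volume.restrict (Metric.ball c l)) ^ 2
      ≤ (ENNReal.ofReal (d * l ^ 2) + ENNReal.ofReal (d * l ^ 2)) ^ 2 := by
        gcongr
        exact (eLpNorm_add_le hwm ham one_le_two).trans (add_le_add (hθle j) hale)
    _ = _ := by
        rw [← ENNReal.ofReal_add hq.le hq.le, ← ENNReal.ofReal_pow (by positivity)]
        congr 1
        ring

/-- The upper bound for the eigenvalue obtained from a Lebesgue point at which the field is `k`. -/
lemma eventually_dirichletEigenvalue_le (hΩ : IsOpen Ω) (hΩb : Bornology.IsBounded Ω)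
    (hA : ∀ k, MemLp (fun x => A x k) 2 (volume.restrict Ω))
    (hB : MemLp B 2 (volume.restrict Ω)) (hcurl : HasWeakCurl Ω (fun k x => A x k) B)
    {c : Plane} (hc : c ∈ Ω) {k : ℝ} (hk : 0 < k)
    (hleb : ∀ δ : ℝ, 0 < δ → ∀ᶠ l in nhdsWithin (0 : ℝ) (Ioi 0),
      ∫⁻ x in Metric.closedBall c l, ‖Ω.indicator B x - k‖ₑ ^ 2 ≤ ENNReal.ofReal (δ * l ^ 2))
    {ε : ℝ} (hε : 0 < ε) :
    ∀ᶠ σ : ℝ in atTop, dirichletEigenvalue σ A Ω ≤ ENNReal.ofReal ((k + ε) * σ) := by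
  obtain ⟨f, hf, hfc, hF, hfE⟩ := exists_energy_le hk (by positivity : 0 < ε / 4)
  set F : ℝ := ∫ x, f x ^ 2 with hF_def
  obtain ⟨M, hM⟩ := hf.continuous.bounded_above_of_compact_support hfc
  obtain ⟨L, hL, hLs⟩ := hfc.isCompact.isBounded.subset_closedBall_lt 0 0
  -- Chosen so that `(1 + η)(k + ε/4) = k + ε/2`, leaving `ε/2` for the potential error.
  set η : ℝ := ε / 4 / (k + ε / 4) with hη_def
  have hη : 0 < η := by positivity
  have hηk : (1 + η) * (k + ε / 4) = k + ε / 2 := by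
    rw [hη_def]
    field_simp
    ring
  -- This collects the error constant: `(1 + η⁻¹)(σM)²` times two components of `4 d² l⁴`. With `l =
  -- 2L/√σ` the powers of `σ` cancel, so `d` can be fixed before `σ`.
  set K : ℝ := (1 + η⁻¹) * M ^ 2 * (8 * (2 * L) ^ 4) with hK
  have hK0 : 0 ≤ K := by positivity
  obtain ⟨d, hd, hKd⟩ : ∃ d : ℝ, 0 < d ∧ K * d ^ 2 ≤ ε / 2 * F := by
    have ht : Tendsto (fun d : ℝ => K * d ^ 2) (nhdsWithin 0 (Ioi 0)) (nhds (K * 0 ^ 2)) :=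
      ((continuous_const.mul (continuous_id.pow 2)).tendsto 0).mono_left nhdsWithin_le_nhds
    have h0 : K * 0 ^ 2 < ε / 2 * F := by simpa using (by positivity : 0 < ε / 2 * F)
    obtain ⟨d, h1, h2⟩ := ((ht.eventually (gt_mem_nhds h0)).and self_mem_nhdsWithin).exists
    exact ⟨d, h2, h1.le⟩
  -- The rescaled support has radius at most `L / √σ`; doubling it places the closed support inside
  -- the open ball where `θ` is smooth.
  have hl_tendsto : Tendsto (fun σ : ℝ => 2 * L / √σ) atTop (nhdsWithin 0 (Ioi 0)) := by
    refine tendsto_nhdsWithin_iff.2 ⟨Real.tendsto_sqrt_atTop.const_div_atTop _, ?_⟩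
    filter_upwards [eventually_gt_atTop 0] with σ hσ
    exact div_pos (by positivity) (Real.sqrt_pos.2 hσ)
  obtain ⟨R, hR, hball⟩ := Metric.isOpen_iff.1 hΩ c hc
  have hsmall : ∀ᶠ l in nhdsWithin (0 : ℝ) (Ioi 0), 2 * l < R := by
    filter_upwards [nhdsWithin_le_nhds (gt_mem_nhds (half_pos hR))] with l hl
    linarith
  filter_upwards [hl_tendsto.eventually (hleb (d ^ 2) (by positivity)),
    hl_tendsto.eventually hsmall, eventually_gt_atTop 0] with σ hσ1 hσ2 hσ
  have hs : 0 < √σ := Real.sqrt_pos.2 hσ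
  have hs2 : √σ ^ 2 = σ := Real.sq_sqrt hσ.le
  set l : ℝ := 2 * L / √σ with hl_def
  have hl : 0 < l := by positivity
  have hballl : Metric.ball c (2 * l) ⊆ Ω := (Metric.ball_subset_ball hσ2.le).trans hball
  obtain ⟨θ, hθ, hθle⟩ := exists_gauge hΩ hΩb hA hB hcurl hd hl hballl hσ1
  have hsub : Metric.ball c l ⊆ Ω := (Metric.ball_subset_ball (by linarith)).trans hballl
  obtain ⟨hv, hvs, hvF, hvE⟩ := rescaled_testFunction hf hLs c hs k rfl
  set v : Plane → ℝ := fun x => f (√σ • (x - c)) with hv_def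
  have hvc : HasCompactSupport v :=
    (isCompact_closedBall c (L / √σ)).of_isClosed_subset isClosed_closure hvs
  have hvl : tsupport v ⊆ Metric.ball c l := by
    refine hvs.trans (Metric.closedBall_subset_ball ?_)
    rw [hl_def]
    exact div_lt_div_of_pos_right (by linarith) hs
  have hn := lintegral_enorm_gaugedFunction_sq (σ := σ) (θ := θ) hv.continuous hvc
    (hvl.trans hsub)
  have hle := magneticEnergy_gaugedFunction_le (σ := σ) (Ω := Ω) (A := A) Metric.isOpen_ball
    (fun j => ((hA j).mono_measure (Measure.restrict_mono_set _ hsub)).aestronglyMeasurable)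
    hθ hv hvc hvl (M := M) (fun x => hM _) (a := fun j x => k * canonicalPotential (x - c) j)
    (fun j => continuous_const.mul ((continuous_canonicalPotential_apply j).comp
      (continuous_id.sub continuous_const))) hη
  rw [hs2] at hvE hvF
  rw [hvF] at hn
  have hFσ : 0 < σ⁻¹ * F := by positivity
  have h0 : ∫⁻ x in Ω, ‖gaugedFunction σ θ v x‖ₑ ^ 2 ≠ 0 := by
    rw [hn]
    exact (ENNReal.ofReal_pos.2 hFσ).ne'
  refine (dirichletEigenvalue_le_of_contDiff
    (contDiff_gaugedFunction Metric.isOpen_ball hθ hv hvl)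
    (hvc.of_isClosed_subset isClosed_closure tsupport_gaugedFunction_subset)
    (tsupport_gaugedFunction_subset.trans (hvl.trans hsub)) h0).trans ?_
  rw [hn]
  refine ENNReal.div_le_of_le_mul ?_
  rw [← ENNReal.ofReal_mul (by positivity)]
  calc _ ≤ _ := hle
    _ ≤ ENNReal.ofReal ((k + ε / 2) * F) + ENNReal.ofReal ((1 + η⁻¹) * (σ * M) ^ 2) *
        ∑ _j : Fin 2, ENNReal.ofReal (4 * d ^ 2 * l ^ 4) := by
      refine add_le_add (ENNReal.ofReal_le_ofReal ?_)
        (mul_le_mul' le_rfl (Finset.sum_le_sum fun j _ => hθle j))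
      rw [hvE, ← hηk, mul_assoc]
      exact mul_le_mul_of_nonneg_left hfE (by positivity)
    _ = ENNReal.ofReal ((k + ε / 2) * F + K * d ^ 2) := by
      rw [Fin.sum_univ_two, ← ENNReal.ofReal_add (by positivity) (by positivity),
        ← ENNReal.ofReal_mul (by positivity),
        ← ENNReal.ofReal_add (by positivity) (by positivity)]
      congr 2
      have h4 : √σ ^ 4 = σ ^ 2 := by rw [← hs2]; ring_nf; rw [hs2]
      rw [hK, hl_def, div_pow, h4]
      field_simp
      ring
    _ ≤ _ := by
      refine ENNReal.ofReal_le_ofReal ?_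
      have : (k + ε) * σ * (σ⁻¹ * F) = (k + ε / 2) * F + ε / 2 * F := by
        field_simp
        ring
      linarith

end UpperBound

/-! ### The essential infimum and the conclusion -/

/-- The real `sSup` of an empty or unbounded set is `0`, so positivity makes it a genuine supremum.
It is attained because the sequence `1 / (n + 1)` involves only countably many null sets. -/
lemma ae_essInfOn_le {Ω : Set Plane} {B : Plane → ℝ} (hpos : 0 < essInfOn B Ω) :
    (∀ᵐ x ∂(volume.restrict Ω), essInfOn B Ω ≤ B x) ∧
    ∀ ε > 0, ¬ ∀ᵐ x ∂(volume.restrict Ω), essInfOn B Ω + ε ≤ B x := by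
  set S : Set ℝ := {c : ℝ | ∀ᵐ x ∂(volume.restrict Ω), c ≤ B x} with hS
  have hbdd : BddAbove S := by
    by_contra h
    exact hpos.ne' (Real.sSup_of_not_bddAbove h)
  have hne : S.Nonempty := by
    rw [nonempty_iff_ne_empty]
    intro h
    refine hpos.ne' ?_
    change sSup S = 0
    rw [h, Real.sSup_empty]
  refine ⟨?_, fun ε hε h => ?_⟩
  · have h1 : ∀ n : ℕ, ∀ᵐ x ∂(volume.restrict Ω), essInfOn B Ω - 1 / ((n : ℝ) + 1) < B x := by
      intro n
      obtain ⟨c, hc, hlt⟩ := exists_lt_of_lt_csSup hne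
        (sub_lt_self (sSup S) (by positivity : 0 < 1 / ((n : ℝ) + 1)))
      filter_upwards [hc] with x hx using hlt.trans_le hx
    filter_upwards [ae_all_iff.2 h1] with x hx
    refine le_of_forall_pos_lt_add fun ε hε => ?_
    obtain ⟨n, hn⟩ := exists_nat_one_div_lt hε
    linarith [hx n]
  · have : essInfOn B Ω + ε ≤ essInfOn B Ω := le_csSup hbdd h
    linarith

/-- There are points of `Ω` at which the field is nearly minimal and which are `L²`-Lebesgue points
of the field. -/
lemma exists_lebesguePoint {Ω : Set Plane} (hΩ : IsOpen Ω) {B : Plane → ℝ}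
    (hB : MemLp B 2 (volume.restrict Ω)) (hpos : 0 < essInfOn B Ω) {ε : ℝ} (hε : 0 < ε) :
    ∃ c ∈ Ω, essInfOn B Ω ≤ B c ∧ B c < essInfOn B Ω + ε ∧
      ∀ δ : ℝ, 0 < δ → ∀ᶠ l in nhdsWithin (0 : ℝ) (Ioi 0),
        ∫⁻ x in Metric.closedBall c l, ‖Ω.indicator B x - B c‖ₑ ^ 2 ≤
          ENNReal.ofReal (δ * l ^ 2) := by
  have hb : MemLp (Ω.indicator B) 2 volume := (memLp_indicator_iff_restrict hΩ.measurableSet).2 hB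
  obtain ⟨h1, h2⟩ := ae_essInfOn_le hpos
  have h3 := not_eventually.1 (h2 ε hε)
  -- The set where `B < m₀ + ε` is not null, so it meets the full-measure set of Lebesgue points
  -- where also `B ≥ m₀`.
  obtain ⟨c, hc, ⟨h4, h5⟩, h6⟩ := (h3.and_eventually ((h1.and (ae_restrict_of_ae
    (ae_eventually_lintegral_sub_sq_le hb))).and (ae_restrict_mem hΩ.measurableSet))).exists
  refine ⟨c, h6, h4, not_le.1 hc, ?_⟩
  simpa [indicator_of_mem h6] using h5

/-- Eigenvalue asymptotics for square integrable potentials with weak curl `B`. -/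
lemma dirichletEigenvalue_asymptotics {Ω : Set Plane} {A : Plane → Plane} {B : Plane → ℝ}
    (hΩ : IsOpen Ω) (hΩb : Bornology.IsBounded Ω) (hne : Ω.Nonempty)
    (hA : ∀ k, MemLp (fun x => A x k) 2 (volume.restrict Ω))
    (hB : MemLp B 2 (volume.restrict Ω)) (hcurl : HasWeakCurl Ω (fun k x => A x k) B)
    (hpos : 0 < essInfOn B Ω) :
    (∀ σ : ℝ, 0 < σ → ENNReal.ofReal (essInfOn B Ω * σ) ≤ dirichletEigenvalue σ A Ω) ∧
    ∃ r : ℝ → ℝ, r =o[atTop] (fun σ : ℝ => σ) ∧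
      ∀ σ : ℝ, 0 < σ →
        dirichletEigenvalue σ A Ω ≤ ENNReal.ofReal (essInfOn B Ω * σ + r σ) := by
  have hlower : ∀ σ : ℝ, 0 < σ →
      ENNReal.ofReal (essInfOn B Ω * σ) ≤ dirichletEigenvalue σ A Ω := by
    intro σ hσ
    refine le_iInf₂ fun u g => le_iInf₂ fun hu hu0 => ?_
    refine (ENNReal.le_div_iff_mul_le (Or.inl fun h => hu0 ?_) (Or.inl ?_)).2
      (mul_lintegral_le_magneticEnergy hA hB hcurl (ae_essInfOn_le hpos).1 hσ hu)
    · have := (lintegral_eq_zero_iff'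
        (hu.hasH1Grad.memLp.aestronglyMeasurable.enorm.pow_const 2)).1 h
      filter_upwards [this] with x hx
      simpa using hx
    · rw [← eLpNorm_two_sq]
      exact ENNReal.pow_ne_top hu.hasH1Grad.memLp.eLpNorm_ne_top
  have hfin : ∀ σ, dirichletEigenvalue σ A Ω ≠ ⊤ := fun σ =>
    (dirichletEigenvalue_lt_top hΩ hne hA σ).ne
  -- The remainder is the exact difference, meaningful because the eigenvalue is finite. The lower
  -- bound makes it nonnegative for `σ > 0`, so only an upper estimate is needed for `o(σ)`.
  refine ⟨hlower, fun σ => (dirichletEigenvalue σ A Ω).toReal - essInfOn B Ω * σ, ?_, ?_⟩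
  · refine Asymptotics.isLittleO_iff.2 fun ε hε => ?_
    obtain ⟨c, hc, hc1, hc2, hleb⟩ := exists_lebesguePoint hΩ hB hpos (half_pos hε)
    filter_upwards [eventually_dirichletEigenvalue_le hΩ hΩb hA hB hcurl hc (hpos.trans_le hc1)
      hleb (half_pos hε), eventually_gt_atTop 0] with σ hσ hσ0
    have h1 := ENNReal.toReal_le_of_le_ofReal (by nlinarith) hσ
    have h2 := (ENNReal.ofReal_le_iff_le_toReal (hfin σ)).1 (hlower σ hσ0)
    rw [Real.norm_of_nonneg (sub_nonneg.2 h2), Real.norm_of_nonneg hσ0.le]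
    nlinarith
  · intro σ _
    rw [add_sub_cancel, ENNReal.ofReal_toReal (hfin σ)]

lemma IsH1Potential.memLp_hasWeakCurl {Ω : Set Plane} {A : Plane → Plane} {B : Plane → ℝ}
    (h : IsH1Potential Ω B A) : (∀ k, MemLp (fun x => A x k) 2 (volume.restrict Ω)) ∧
      HasWeakCurl Ω (fun k x => A x k) B := by
  obtain ⟨D, hD, hB⟩ := h
  refine ⟨fun k => (hD k).memLp, fun φ hφ hc hs => ?_⟩
  have hL : MemLp φ 2 (volume.restrict Ω) :=
    (hφ.continuous.memLp_of_hasCompactSupport hc).restrict Ω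
  have hdL : ∀ v, MemLp (fun x => fderiv ℝ φ x v) 2 (volume.restrict Ω) := fun v =>
    ((hφ.fderiv_apply_const v).continuous.memLp_of_hasCompactSupport
      (hc.fderiv_apply_const v)).restrict Ω
  have i1 : ∀ j k, Integrable (fun x => fderiv ℝ φ x (stdVec j) * A x k) (volume.restrict Ω) :=
    fun j k => (hdL _).integrable_mul (hD k).memLp
  have i2 : ∀ j k, Integrable (fun x => φ x * D j k x) (volume.restrict Ω) :=
    fun j k => hL.integrable_mul ((hD k).memLp_grad j)
  have h1 := (hD 1).weak 0 φ hφ hc hs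
  have h2 := (hD 0).weak 1 φ hφ hc hs
  simp only [smul_eq_mul] at h1 h2
  have h3 : ∫ x in Ω, φ x * B x = ∫ x in Ω, (φ x * D 0 1 x - φ x * D 1 0 x) := by
    refine integral_congr_ae ?_
    filter_upwards [hB] with x hx
    rw [← hx]
    ring
  rw [h3, integral_sub (i1 0 1) (i1 1 0), integral_sub (i2 0 1) (i2 1 0), h1, h2]
  ring

/-- This potential is the centred one with centre `0`. Its weak curl is the extension `B'`, and test
functions supported in `Ω` see only the values of `B'` there. -/
lemma magneticPotential_memLp_hasWeakCurl {Ω : Set Plane} (hΩb : Bornology.IsBounded Ω)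
    {B B' : Plane → ℝ} (hB' : MemLp B' 2 volume) (hBB : ∀ᵐ x ∂(volume.restrict Ω), B' x = B x) :
    (∀ k, MemLp (fun x => magneticPotential B' x k) 2 (volume.restrict Ω)) ∧
      HasWeakCurl Ω (fun k x => magneticPotential B' x k) B := by
  simp only [magneticPotential_apply]
  refine ⟨fun k => memLp_radialPotential hB' hΩb k, fun φ hφ hc hs => ?_⟩
  have h := hasWeakCurl_centeredPotential hB' 0 Ω φ hφ hc hs
  simp only [centeredPotential, zero_add, sub_zero] at h
  rw [h]
  congr 1
  refine integral_congr_ae ?_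
  filter_upwards [hBB] with x hx
  rw [hx]

end

theorem theorem1p2 (N : ℕ) (hN : 1 ≤ N) (Ωs : Fin N → Set Plane)
    (hΩs : ∀ i, IsC1Domain (Ωs i))
    (hdisj : Pairwise (fun i j => Disjoint (closure (Ωs i)) (closure (Ωs j))))
    (Ω : Set Plane) (hΩ : Ω = ⋃ i, Ωs i)
    (B : Plane → ℝ) (hB : MemH1 Ω B) (hpos : 0 < essInfOn B Ω)
    (A : Plane → Plane)
    (hA : (∃ B' : Plane → ℝ, MemH1 univ B' ∧ (∀ᵐ x ∂(volume.restrict Ω), B' x = B x) ∧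
        A = magneticPotential B') ∨ IsH1Potential Ω B A) :
    (∀ σ : ℝ, 0 < σ → ENNReal.ofReal (essInfOn B Ω * σ) ≤ dirichletEigenvalue σ A Ω) ∧
    ∃ r : ℝ → ℝ, r =o[atTop] (fun σ : ℝ => σ) ∧
      ∀ σ : ℝ, 0 < σ →
        dirichletEigenvalue σ A Ω ≤ ENNReal.ofReal (essInfOn B Ω * σ + r σ) := by
  have hopen : IsOpen Ω := hΩ ▸ isOpen_iUnion fun i => (hΩs i).isOpen
  have hbdd : Bornology.IsBounded Ω :=
    hΩ ▸ Bornology.isBounded_iUnion.2 fun i => (hΩs i).isBounded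
  have hne : Ω.Nonempty := by
    rw [hΩ]
    exact nonempty_iUnion.2 ⟨⟨0, hN⟩, (hΩs _).isConnected.nonempty⟩
  obtain ⟨_, hBg⟩ := hB
  have hAL : (∀ k, MemLp (fun x => A x k) 2 (volume.restrict Ω)) ∧
      HasWeakCurl Ω (fun k x => A x k) B := by
    rcases hA with ⟨B', ⟨_, hB'⟩, hBB, rfl⟩ | hA
    · have hL := hB'.memLp
      rw [Measure.restrict_univ] at hL
      exact magneticPotential_memLp_hasWeakCurl hbdd hL hBB
    · exact hA.memLp_hasWeakCurl
  exact dirichletEigenvalue_asymptotics hopen hbdd hne hAL.1 hBg.memLp hAL.2 hpos
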